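/- Let $T=\triangle ABC$ be a (nondegenerate) triangle in the Euclidean plane with angles $a,b,c$ at $A,B,C$ respectively, such that $a<c$ and $a/\pi$ is irrational. *Subdivision rule.* A labelled triangle $ABC$ with angles $a,b,c$ at its vertices, where $a<c$, is split as follows. Let $F$ be the point on $AB$ with $\angle FCB=a$, let $D$ be the point on $AC$ with $\angle DFC=b$, let $E$ be the point on $AB$ with $\angle ADE=b$, and let $G$ be the point on $CF$ with $\angle GDC=a$. Then $ABC$ is divided into the five labelled triangles $ADE$, $FDE$, $DFG$, $DCG$, $CBF$, where the order of writing gives the labels: the first, second and third vertex take the roles of $A$, $B$ and $C$ when the rule is applied to these triangles in turn. (With these labels $ADE$, $DFG$ and $CBF$ have angles $a,b,c$, and $FDE$ and $DCG$ have angles $a,\,c-a,\,\pi-c$; the rule applies again to each of them.) A *generalized pinwheel tiling* of a labelled triangle is a finite set of labelled triangles (tiles) obtained from it by applying the rule recursively finitely many times (possibly zero times). For a generalized pinwheel tiling $\mathcal T$ let $\mathrm{Sk}(\mathcal T)$ be the union of all edges of all its tiles, and let $\mathrm{dist}_{\mathrm{Sk}(\mathcal T)}(P,Q)\in[0,\infty]$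 be the infimum of the lengths of the paths from $P$ to $Q$ contained in $\mathrm{Sk}(\mathcal T)$. A tiling $\mathcal T'$ *refines* $\mathcal T$ if for each tile $\tau\in\mathcal T$ either $\tau$ itself belongs to $\mathcal T'$ or the tiles of some generalized pinwheel tiling of $\tau$ all belong to $\mathcal T'$. **Theorem.** Let $\mathcal T^0,\mathcal T^1,\ldots$ be a sequence of generalized pinwheel tilings of $T$ such that $\mathcal T^{i+1}$ refines $\mathcal T^i$ for all $i\ge 0$ and such that the maximum tile diameter of $\mathcal T^i$ tends to $0$ as $i\to\infty$. Let $P,Q$ be any two distinct points lying on $\mathrm{Sk}(\mathcal T^n)$ for some $n$. Then $$\lim_{\substack{m\to\infty\\ m\ge n}}\mathrm{dist}_{\mathrm{Sk}(\mathcal T^m)}(P,Q)=\|P-Q\|.$$ -/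

import Mathlib

open Filter Topology
open scoped EuclideanGeometry ENNReal Real

namespace Pinwheel

/-- The Euclidean plane. -/
abbrev Plane : Type := EuclideanSpace ℝ (Fin 2)

/-- A tile: a triangle with labelled vertices `A`, `B`, `C`. -/
@[ext]
structure Tile where
  A : Plane
  B : Plane
  C : Plane

namespace Tile

/-- The angle at the vertex `A`. -/
noncomputable def angleA (T : Tile) : ℝ := ∠ T.B T.A T.C

/-- The angle at the vertex `B`. -/
noncomputable def angleB (T : Tile) : ℝ := ∠ T.A T.B T.C

/-- The angle at the vertex `C`. -/
noncomputable def angleC (T : Tile) : ℝ := ∠ T.A T.C T.B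

/-- The three vertices are not collinear. -/
def Nondegenerate (T : Tile) : Prop := AffineIndependent ℝ ![T.A, T.B, T.C]

/-- The closed triangular region. -/
def region (T : Tile) : Set Plane := convexHull ℝ {T.A, T.B, T.C}

/-- The union of the three edges. -/
def boundary (T : Tile) : Set Plane :=
  segment ℝ T.A T.B ∪ segment ℝ T.B T.C ∪ segment ℝ T.C T.A

end Tile

/-- The construction of the points `D`, `E`, `F`, `G` in a triangle `ABC` with angles `a`, `b`, `c`:
`F` on `AB` with `∠FCB = a`, `D` on `AC` with `∠DFC = b`, `E` on `AB` with `∠ADE = b`, and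
`G` on `CF` with `∠GDC = a`.
The angles are unoriented, so that mirror images of tiles are split by the mirrored rule. -/
structure IsSplit (T : Tile) (D E F G : Plane) : Prop where
  F_mem : Sbtw ℝ T.A F T.B
  F_angle : ∠ F T.C T.B = T.angleA
  D_mem : Sbtw ℝ T.A D T.C
  D_angle : ∠ D F T.C = T.angleB
  E_mem : Sbtw ℝ T.A E T.B
  E_angle : ∠ T.A D E = T.angleB
  G_mem : Sbtw ℝ T.C G F
  G_angle : ∠ G D T.C = T.angleA

/-- `IsTiling T S`: the set `S` of tiles is a generalized pinwheel tiling of `T`, that is, it arises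
from `T` by finitely many applications of the subdivision rule.

In the subdivision of `T`, the triangles `ADE`, `CBF`, `DFG` are similar to `ABC` (angles `a, b, c`,
in the order of the vertices as written), and `FDE`, `DCG` are conjugate to `ABC`
(angles `a, c - a, π - c`, in the order of the vertices as written). The labels of the children are
the ones with which the rule is applied to them in turn. -/
inductive IsTiling : Tile → Set Tile → Prop
  | root (T : Tile) : IsTiling T {T}
  | split (T : Tile) (D E F G : Plane) (h : IsSplit T D E F G) (S₁ S₂ S₃ S₄ S₅ : Set Tile)
      (h₁ : IsTiling ⟨T.A, D, E⟩ S₁) (h₂ : IsTiling ⟨F, D, E⟩ S₂) (h₃ : IsTiling ⟨D, F, G⟩ S₃)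
      (h₄ : IsTiling ⟨D, T.C, G⟩ S₄) (h₅ : IsTiling ⟨T.C, T.B, F⟩ S₅) :
      IsTiling T (S₁ ∪ S₂ ∪ S₃ ∪ S₄ ∪ S₅)

/-- `Refines S' S`: every tile of `S` appears in `S'`, either itself or subdivided. -/
def Refines (S' S : Set Tile) : Prop := ∀ τ ∈ S, ∃ R ⊆ S', IsTiling τ R

/-- The maximum tile diameter. -/
noncomputable def meshSize (S : Set Tile) : ℝ≥0∞ := ⨆ τ ∈ S, Metric.ediam τ.region

/-- The 1-skeleton: the union of all edges of all tiles. -/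
def skeleton (S : Set Tile) : Set Plane := ⋃ τ ∈ S, τ.boundary

/-- The length of a path. -/
noncomputable def pathLength {P Q : Plane} (γ : Path P Q) : ℝ≥0∞ := eVariationOn γ Set.univ

/-- The distance from `P` to `Q` within the 1-skeleton: the infimum of the lengths of the paths from
`P` to `Q` that stay in the skeleton (`∞` if there is none). -/
noncomputable def skeletonDist (S : Set Tile) (P Q : Plane) : ℝ≥0∞ :=
  ⨅ (γ : Path P Q) (_ : Set.range γ ⊆ skeleton S), pathLength γ

end Pinwheel

/-!
The skeleta increase with the refinement, so the skeleton distances from `P` decrease, and no path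
is shorter than the segment. What has to be shown is that the limit distance is at most the
Euclidean one.

*A crude bound.* A chord of a triangle can be replaced by a detour along the boundary that is longer
by at most the factor `cornerConst α`, where `α` bounds the angles from below. Only two shapes of
tiles occur (`IsShape`), and a subdivided tile is glued from its parts along cevians
(`SplitGeometry.chordBound_union`): a segment that changes sides meets the cevian, which belongs to
both skeleta, so that the detour factor is not affected (`ChordBound.union`). Therefore every
skeleton has chord bound `K` with the same `K` (`IsTiling.chordBound`), and the limit distance from
`P` is a `K`-Lipschitz function on the union of the skeleta. It extends to a `K`-Lipschitz function
`g` on the plane, and `|g r - g q| ≤ dist q r` whenever the segment `qr` lies in some skeleton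
(`exists_lipschitz_limit`).

*The gradient.* By Rademacher's theorem `g` is differentiable almost everywhere. Let `y` be such a
point of the triangle. Small tiles around `y` contain, after refinement, edges in many directions:
the child `FDE` of a tile is turned by the angle `a` up to a half turn, always in the same sense
when this is repeated (`SplitGeometry.dirB_tile₂`, `SplitGeometry.dirC_tile₂`,
`IsTiling.exists_edge`). Since `a / π` is irrational, a bounded number of repetitions yields an edge
almost parallel to the gradient of `g` at `y` (`exists_uniform_cos`), whose length is a definite
fraction of the size of the tile. By differentiability, it need not pass through `y` for
`|g r - g q| ≤ dist q r` to bound the derivative in its direction. Thus `‖fderiv ℝ g y‖ ≤ 1`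
(`norm_fderiv_le_one`).

*Conclusion.* A Lipschitz function whose gradient is at most `1` almost everywhere on a convex body
is `1`-Lipschitz there (`abs_sub_le_of_ae_norm_fderiv_le`), and so `g Q = g Q - g P ≤ ‖P - Q‖`.
-/

namespace Pinwheel

/-! ### Distances within a subset of the plane -/

/-- The distance from `P` to `Q` within a set `X`: the infimum of the lengths of the paths from `P`
to `Q` that stay in `X`. The skeleton distance is the case `X = skeleton S`. -/
noncomputable def setDist (X : Set Plane) (P Q : Plane) : ℝ≥0∞ :=
  ⨅ (γ : Path P Q) (_ : Set.range γ ⊆ X), pathLength γ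

lemma pathLength_trans_le {P Q R : Plane} (γ : Path P Q) (δ : Path Q R) :
    pathLength (γ.trans δ) ≤ pathLength γ + pathLength δ := by
  have hhalf : (1 / 2 : ℝ) ∈ Set.Icc (0 : ℝ) 1 := by norm_num
  set h : unitInterval := ⟨1 / 2, hhalf⟩ with hh
  have huniv : (Set.univ : Set unitInterval) = Set.Iic h ∪ Set.Ici h := by
    rw [Set.Iic_union_Ici]
  unfold pathLength
  rw [huniv, eVariationOn.union _ (x := h) isGreatest_Iic isLeast_Ici]
  refine add_le_add ?_ ?_
  · have : Set.EqOn (γ.trans δ)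
        (γ ∘ fun t : unitInterval => Set.projIcc (0 : ℝ) 1 zero_le_one (2 * (t : ℝ)))
        (Set.Iic h) := by
      intro t ht
      have ht' : (t : ℝ) ≤ 1 / 2 := ht
      simp only [Path.trans_apply, Function.comp]
      rw [dif_pos ht', Set.projIcc_of_mem zero_le_one]
    rw [eVariationOn.congr this]
    refine (eVariationOn.comp_le_of_monotoneOn _ (s := Set.univ) _ ?_ (Set.mapsTo_univ _ _)).trans
      (eVariationOn.mono _ (by simp))
    intro x _ y _ hxy
    exact Set.monotone_projIcc _ (by have : (x : ℝ) ≤ y := hxy; linarith)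
  · have : Set.EqOn (γ.trans δ)
        (δ ∘ fun t : unitInterval => Set.projIcc (0 : ℝ) 1 zero_le_one (2 * (t : ℝ) - 1))
        (Set.Ici h) := by
      intro t ht
      have ht' : 1 / 2 ≤ (t : ℝ) := ht
      have ht1 := t.2.2
      simp only [Path.trans_apply, Function.comp]
      split_ifs with h'
      · have : (t : ℝ) = 1 / 2 := le_antisymm h' ht'
        simp [this]
      · rw [Set.projIcc_of_mem zero_le_one]
    rw [eVariationOn.congr this]
    refine (eVariationOn.comp_le_of_monotoneOn _ (s := Set.univ) _ ?_ (Set.mapsTo_univ _ _)).trans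
      (eVariationOn.mono _ (by simp))
    intro x _ y _ hxy
    exact Set.monotone_projIcc _ (by have : (x : ℝ) ≤ y := hxy; linarith)

lemma setDist_triangle (X : Set Plane) (P Q R : Plane) :
    setDist X P R ≤ setDist X P Q + setDist X Q R := by
  unfold setDist
  simp only [ENNReal.iInf_add, ENNReal.add_iInf]
  refine le_iInf fun δ => le_iInf fun hδ => le_iInf fun γ => le_iInf fun hγ => ?_
  refine (iInf₂_le (γ.trans δ) ?_).trans (pathLength_trans_le γ δ)
  rw [Path.trans_range]
  exact Set.union_subset hγ hδ

lemma setDist_mono {X Y : Set Plane} (h : X ⊆ Y) (P Q : Plane) : setDist Y P Q ≤ setDist X P Q :=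
  le_iInf₂ fun γ hγ => iInf₂_le γ (hγ.trans h)

lemma edist_le_setDist (X : Set Plane) (P Q : Plane) : edist P Q ≤ setDist X P Q := by
  refine le_iInf₂ fun γ _ => ?_
  have := eVariationOn.edist_le γ (Set.mem_univ (0 : unitInterval)) (Set.mem_univ 1)
  rwa [γ.source, γ.target] at this

lemma pathLength_segment_le (P Q : Plane) : pathLength (Path.segment P Q) ≤ edist P Q := by
  have hL : LipschitzOnWith (nndist P Q) (AffineMap.lineMap P Q : ℝ → Plane) Set.univ :=
    (lipschitzWith_lineMap P Q).lipschitzOnWith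
  have h1 : pathLength (Path.segment P Q)
      = eVariationOn ((AffineMap.lineMap P Q : ℝ → Plane) ∘ ((↑) : unitInterval → ℝ)) Set.univ := by
    refine eVariationOn.congr fun t _ => ?_
    simp
  have h2 : eVariationOn ((↑) : unitInterval → ℝ) Set.univ ≤ 1 := by
    have hm : MonotoneOn ((↑) : unitInterval → ℝ) Set.univ := fun x _ y _ h => h
    have := hm.eVariationOn_eq (Set.mem_univ (0 : unitInterval)) (Set.mem_univ 1)
    have he : (Set.univ : Set unitInterval) ∩ Set.Icc 0 1 = Set.univ := by
      ext x; exact ⟨fun _ => trivial, fun _ => ⟨trivial, x.2⟩⟩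
    rw [he] at this
    simp [this]
  rw [h1]
  calc _ ≤ (nndist P Q : ℝ≥0∞) * eVariationOn ((↑) : unitInterval → ℝ) Set.univ :=
        hL.comp_eVariationOn_le (Set.mapsTo_univ _ _)
    _ ≤ nndist P Q * 1 := by gcongr
    _ = edist P Q := by rw [mul_one, edist_nndist]

lemma setDist_le_edist {X : Set Plane} {P Q : Plane} (h : segment ℝ P Q ⊆ X) :
    setDist X P Q ≤ edist P Q :=
  (iInf₂_le (Path.segment P Q) (by rwa [Path.range_segment])).trans (pathLength_segment_le P Q)

/-- Any two points of `X` are joined by paths in `X` of length at most `K` times their Euclidean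
distance, up to an arbitrarily small error. -/
def ChordBound (K : ℝ≥0∞) (X : Set Plane) : Prop :=
  ∀ P ∈ X, ∀ Q ∈ X, setDist X P Q ≤ K * edist P Q

lemma exists_mem_segment_inter {R₁ R₂ : Set Plane} (h₁ : IsClosed R₁) (h₂ : IsClosed R₂)
    (hconv : Convex ℝ (R₁ ∪ R₂)) {P Q : Plane} (hP : P ∈ R₁) (hQ : Q ∈ R₂) :
    ∃ M ∈ segment ℝ P Q, M ∈ R₁ ∩ R₂ := by
  have hpre : IsPreconnected (segment ℝ P Q) := (convex_segment P Q).isPreconnected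
  have hsub : segment ℝ P Q ⊆ R₁ ∪ R₂ := hconv.segment_subset (Or.inl hP) (Or.inr hQ)
  exact isPreconnected_closed_iff.1 hpre R₁ R₂ h₁ h₂ hsub ⟨P, left_mem_segment ℝ P Q, hP⟩
    ⟨Q, right_mem_segment ℝ P Q, hQ⟩

/-- A chord from one side of a convex union to the other passes through a common point of the two
sets `X` and `Y`, and no length is lost there; hence the constant does not deteriorate. -/
lemma ChordBound.union {K : ℝ≥0∞} {X Y R₁ R₂ : Set Plane} (hX : ChordBound K X)
    (hY : ChordBound K Y) (hXR : X ⊆ R₁) (hYR : Y ⊆ R₂) (h₁ : IsClosed R₁) (h₂ : IsClosed R₂)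
    (hconv : Convex ℝ (R₁ ∪ R₂)) (hint : R₁ ∩ R₂ ⊆ X ∩ Y) : ChordBound K (X ∪ Y) := by
  have key : ∀ P Q M : Plane, M ∈ segment ℝ P Q → ∀ Z : Set Plane,
      setDist Z P M ≤ K * edist P M → setDist Z M Q ≤ K * edist M Q →
      setDist Z P Q ≤ K * edist P Q := by
    intro P Q M hM Z h h'
    have hd : edist P M + edist M Q = edist P Q := by
      have := dist_add_dist_of_mem_segment hM
      rw [edist_dist, edist_dist, edist_dist, ← ENNReal.ofReal_add dist_nonneg dist_nonneg, this]
    calc _ ≤ setDist Z P M + setDist Z M Q := setDist_triangle _ _ _ _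
      _ ≤ K * edist P M + K * edist M Q := add_le_add h h'
      _ = K * edist P Q := by rw [← mul_add, hd]
  have hX' : ∀ P ∈ X, ∀ Q ∈ X, setDist (X ∪ Y) P Q ≤ K * edist P Q := fun P hP Q hQ =>
    (setDist_mono Set.subset_union_left P Q).trans (hX P hP Q hQ)
  have hY' : ∀ P ∈ Y, ∀ Q ∈ Y, setDist (X ∪ Y) P Q ≤ K * edist P Q := fun P hP Q hQ =>
    (setDist_mono Set.subset_union_right P Q).trans (hY P hP Q hQ)
  rintro P (hP | hP) Q (hQ | hQ)
  · exact hX' P hP Q hQ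
  · obtain ⟨M, hM, hM'⟩ := exists_mem_segment_inter h₁ h₂ hconv (hXR hP) (hYR hQ)
    exact key P Q M hM _ (hX' P hP M (hint hM').1) (hY' M (hint hM').2 Q hQ)
  · obtain ⟨M, hM, hM'⟩ := exists_mem_segment_inter h₁ h₂ hconv (hXR hQ) (hYR hP)
    rw [segment_symm] at hM
    exact key P Q M hM _ (hY' P hP M (hint hM').2) (hX' M (hint hM').1 Q hQ)
  · exact hY' P hP Q hQ

/-! ### Triangles and cevians -/

lemma mem_convexHull_triple {X Y Z p : Plane} :
    p ∈ convexHull ℝ {X, Y, Z} ↔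
      ∃ α β γ : ℝ, 0 ≤ α ∧ 0 ≤ β ∧ 0 ≤ γ ∧ α + β + γ = 1 ∧ α • X + β • Y + γ • Z = p := by
  constructor
  · intro h
    rw [convexHull_insert ⟨Y, by simp⟩, convexHull_pair, mem_convexJoin] at h
    obtain ⟨x, rfl, q, ⟨u, v, hu, hv, huv, rfl⟩, s, t, hs, ht, hst, rfl⟩ := h
    refine ⟨s, t * u, t * v, hs, by positivity, by positivity, ?_, ?_⟩
    · rw [add_assoc, ← mul_add, huv, mul_one, hst]
    · rw [smul_add, smul_smul, smul_smul, add_assoc]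
  · rintro ⟨α, β, γ, hα, hβ, hγ, hsum, rfl⟩
    have hc := convex_convexHull ℝ ({X, Y, Z} : Set Plane)
    have hX : X ∈ convexHull ℝ ({X, Y, Z} : Set Plane) := subset_convexHull ℝ _ (by simp)
    have hY : Y ∈ convexHull ℝ ({X, Y, Z} : Set Plane) := subset_convexHull ℝ _ (by simp)
    have hZ : Z ∈ convexHull ℝ ({X, Y, Z} : Set Plane) := subset_convexHull ℝ _ (by simp)
    have h3 := hc.sum_mem (t := Finset.univ) (w := ![α, β, γ]) (z := ![X, Y, Z])
      (by intro i _; fin_cases i <;> simpa) (by simp [Fin.sum_univ_three, hsum])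
      (by intro i _; fin_cases i <;> simpa)
    simpa [Fin.sum_univ_three] using h3

lemma isClosed_convexHull_triple (X Y Z : Plane) : IsClosed (convexHull ℝ {X, Y, Z}) :=
  ((Set.toFinite {X, Y, Z}).isCompact_convexHull ℝ).isClosed

/-- A cevian `ZM` cuts the triangle `ZXY` into the triangles `ZXM` and `ZYM`. -/
lemma convexHull_cevian_union {X Y Z M : Plane} (h : Wbtw ℝ X M Y) :
    convexHull ℝ {Z, X, M} ∪ convexHull ℝ {Z, Y, M} = convexHull ℝ {Z, X, Y} := by
  obtain ⟨t, ⟨ht0, ht1⟩, rfl⟩ := h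
  apply Set.Subset.antisymm
  · have hM : AffineMap.lineMap X Y t ∈ convexHull ℝ ({Z, X, Y} : Set Plane) := by
      rw [mem_convexHull_triple]
      exact ⟨0, 1 - t, t, le_rfl, by linarith, ht0, by ring, by
        rw [AffineMap.lineMap_apply_module]; simp⟩
    refine Set.union_subset (convexHull_min ?_ (convex_convexHull ℝ _))
      (convexHull_min ?_ (convex_convexHull ℝ _))
    · rintro x (rfl | rfl | rfl)
      exacts [subset_convexHull ℝ _ (by simp), subset_convexHull ℝ _ (by simp), hM]
    · rintro x (rfl | rfl | rfl)
      exacts [subset_convexHull ℝ _ (by simp), subset_convexHull ℝ _ (by simp), hM]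
  · intro p hp
    rw [mem_convexHull_triple] at hp
    obtain ⟨α, β, γ, hα, hβ, hγ, hsum, rfl⟩ := hp
    rcases eq_or_lt_of_le ht0 with rfl | ht0'
    · right
      rw [mem_convexHull_triple]
      refine ⟨α, γ, β, hα, hγ, hβ, by linarith, ?_⟩
      simp; abel
    rcases eq_or_lt_of_le ht1 with rfl | ht1'
    · left
      rw [mem_convexHull_triple]
      refine ⟨α, β, γ, hα, hβ, hγ, by linarith, ?_⟩
      simp
    -- compare the ratio of the last two barycentric coordinates with that of the point `M`
    rcases le_total (γ * (1 - t)) (β * t) with hle | hle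
    · left
      rw [mem_convexHull_triple]
      refine ⟨α, β - γ / t * (1 - t), γ / t, hα, ?_, by positivity, ?_, ?_⟩
      · rw [sub_nonneg, div_mul_eq_mul_div, div_le_iff₀ ht0']; exact hle
      · field_simp; linear_combination t * hsum
      · rw [AffineMap.lineMap_apply_module]
        match_scalars <;> field_simp
        ring
    · right
      have h1t : 0 < 1 - t := by linarith
      rw [mem_convexHull_triple]
      refine ⟨α, γ - β / (1 - t) * t, β / (1 - t), hα, ?_, by positivity, ?_, ?_⟩
      · rw [sub_nonneg, div_mul_eq_mul_div, div_le_iff₀ h1t]; exact hle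
      · field_simp; linear_combination (1 - t) * hsum
      · rw [AffineMap.lineMap_apply_module]
        match_scalars <;> field_simp
        ring

/-- The two parts of a triangle cut by a cevian `ZM` have only the cevian in common. -/
lemma convexHull_cevian_inter {X Y Z M : Plane} (h : Sbtw ℝ X M Y)
    (hli : LinearIndependent ℝ ![X - Z, Y - Z]) :
    convexHull ℝ {Z, X, M} ∩ convexHull ℝ {Z, Y, M} ⊆ segment ℝ Z M := by
  obtain ⟨⟨t, ⟨ht0, ht1⟩, rfl⟩, hMX, hMY⟩ := h
  have ht0' : 0 < t := lt_of_le_of_ne ht0 (by rintro rfl; simp at hMX)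
  have ht1' : t < 1 := lt_of_le_of_ne ht1 (by rintro rfl; simp at hMY)
  rintro p ⟨h1, h2⟩
  rw [mem_convexHull_triple] at h1 h2
  obtain ⟨α, β, γ, hα, hβ, hγ, hsum, rfl⟩ := h1
  obtain ⟨α', β', γ', hα', hβ', hγ', hsum', heq⟩ := h2
  rw [LinearIndependent.pair_iff] at hli
  have hz := hli (β + γ * (1 - t) - γ' * (1 - t)) (γ * t - γ' * t - β') (by
    rw [AffineMap.lineMap_apply_module] at heq
    have hα1 : α = 1 - β - γ := by linarith
    have hα2 : α' = 1 - β' - γ' := by linarith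
    subst hα1 hα2
    rw [← sub_eq_zero] at heq
    rw [← neg_eq_zero, ← heq]
    module)
  obtain ⟨e1, e2⟩ := hz
  have hβ0 : β = 0 := by
    have h1t : 0 < 1 - t := by linarith
    have hg : 0 ≤ γ - γ' := by
      have : (γ - γ') * t = β' := by linarith
      by_contra hneg
      push Not at hneg
      nlinarith
    have : 0 ≤ (γ - γ') * (1 - t) := by positivity
    linarith
  subst hβ0
  exact ⟨α, γ, hα, hγ, by linarith, by simp⟩

/-- The detour factor forced by an angle of at least `α` is `1 / sin (α / 2)`. -/
noncomputable def cornerConst (α : ℝ) : NNReal := Real.toNNReal (1 / Real.sin (α / 2))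

lemma corner_dist_le {V X Y P Q : Plane} {α : ℝ} (hα0 : 0 < α) (hα : α ≤ ∠ X V Y)
    (hP : P ∈ segment ℝ V X) (hQ : Q ∈ segment ℝ V Y) :
    dist P V + dist V Q ≤ 1 / Real.sin (α / 2) * dist P Q := by
  have hπ : ∠ X V Y ≤ π := EuclideanGeometry.angle_le_pi X V Y
  have hs : 0 < Real.sin (α / 2) := Real.sin_pos_of_pos_of_lt_pi (by linarith) (by linarith)
  rw [segment_eq_image'] at hP hQ
  obtain ⟨s, ⟨hs0, hs1⟩, rfl⟩ := hP
  obtain ⟨t, ⟨ht0, ht1⟩, rfl⟩ := hQ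
  have e1 : dist (V + s • (X - V)) V = s * ‖X - V‖ := by
    rw [dist_eq_norm, add_sub_cancel_left, norm_smul, Real.norm_of_nonneg hs0]
  have e2 : dist V (V + t • (Y - V)) = t * ‖Y - V‖ := by
    rw [dist_comm, dist_eq_norm, add_sub_cancel_left, norm_smul, Real.norm_of_nonneg ht0]
  have e3 : dist (V + s • (X - V)) (V + t • (Y - V)) = ‖s • (X - V) - t • (Y - V)‖ := by
    rw [dist_eq_norm, add_sub_add_left_eq_sub]
  rw [e1, e2, e3, one_div_mul_eq_div, le_div_iff₀ hs]
  refine le_of_sq_le_sq ?_ (norm_nonneg _)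
  have hin : inner ℝ (X - V) (Y - V) = Real.cos (∠ X V Y) * (‖X - V‖ * ‖Y - V‖) := by
    rw [EuclideanGeometry.angle, vsub_eq_sub, vsub_eq_sub,
      InnerProductGeometry.cos_angle_mul_norm_mul_norm]
  rw [norm_sub_sq_real, real_inner_smul_left, real_inner_smul_right, hin, norm_smul, norm_smul,
    Real.norm_of_nonneg hs0, Real.norm_of_nonneg ht0, mul_pow, Real.sin_sq_eq_half_sub,
    mul_div_cancel₀ α two_ne_zero]
  have hcos : Real.cos (∠ X V Y) ≤ Real.cos α := Real.cos_le_cos_of_nonneg_of_le_pi hα0.le hπ hα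
  have h1 : 0 ≤ s * ‖X - V‖ := by positivity
  have h2 : 0 ≤ t * ‖Y - V‖ := by positivity
  have h3 := mul_nonneg (mul_nonneg h1 h2) (sub_nonneg.2 hcos)
  have h4 := mul_nonneg (by linarith [Real.neg_one_le_cos α] : 0 ≤ 1 + Real.cos α)
    (sq_nonneg (s * ‖X - V‖ - t * ‖Y - V‖))
  nlinarith

lemma one_le_cornerConst {α : ℝ} (h0 : 0 < α) (hπ : α ≤ π) : 1 ≤ cornerConst α := by
  have hs : 0 < Real.sin (α / 2) := Real.sin_pos_of_pos_of_lt_pi (by linarith) (by linarith)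
  rw [cornerConst, Real.one_le_toNNReal, le_div_iff₀ hs, one_mul]
  exact Real.sin_le_one _

lemma setDist_corner_le {V X Y P Q : Plane} {α : ℝ} (hα0 : 0 < α) (hα : α ≤ ∠ X V Y)
    (hP : P ∈ segment ℝ V X) (hQ : Q ∈ segment ℝ V Y) {Z : Set Plane}
    (hX : segment ℝ V X ⊆ Z) (hY : segment ℝ V Y ⊆ Z) :
    setDist Z P Q ≤ cornerConst α * edist P Q := by
  have h1 : setDist Z P V ≤ edist P V := setDist_le_edist
    (((convex_segment V X).segment_subset hP (left_mem_segment ℝ V X)).trans hX)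
  have h2 : setDist Z V Q ≤ edist V Q := setDist_le_edist
    (((convex_segment V Y).segment_subset (left_mem_segment ℝ V Y) hQ).trans hY)
  have hs : 0 ≤ 1 / Real.sin (α / 2) := by
    have hπ : ∠ X V Y ≤ π := EuclideanGeometry.angle_le_pi X V Y
    have := Real.sin_pos_of_pos_of_lt_pi (x := α / 2) (by linarith) (by linarith)
    positivity
  calc setDist Z P Q ≤ edist P V + edist V Q :=
        (setDist_triangle Z P V Q).trans (add_le_add h1 h2)
    _ = ENNReal.ofReal (dist P V + dist V Q) := by
        rw [edist_dist, edist_dist, ENNReal.ofReal_add dist_nonneg dist_nonneg]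
    _ ≤ ENNReal.ofReal (1 / Real.sin (α / 2) * dist P Q) :=
        ENNReal.ofReal_le_ofReal (corner_dist_le hα0 hα hP hQ)
    _ = cornerConst α * edist P Q := by
        rw [ENNReal.ofReal_mul hs, edist_dist]; rfl

lemma chordBound_boundary {τ : Tile} {α : ℝ} (h0 : 0 < α) (hA : α ≤ τ.angleA) (hB : α ≤ τ.angleB)
    (hC : α ≤ τ.angleC) : ChordBound (cornerConst α) τ.boundary := by
  have hAB : segment ℝ τ.A τ.B ⊆ τ.boundary := fun x hx => Or.inl (Or.inl hx)
  have hBC : segment ℝ τ.B τ.C ⊆ τ.boundary := fun x hx => Or.inl (Or.inr hx)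
  have hCA : segment ℝ τ.C τ.A ⊆ τ.boundary := fun x hx => Or.inr hx
  have hBA := segment_symm ℝ τ.A τ.B ▸ hAB
  have hCB := segment_symm ℝ τ.B τ.C ▸ hBC
  have hAC := segment_symm ℝ τ.C τ.A ▸ hCA
  have h1 : (1 : ℝ≥0∞) ≤ cornerConst α := by
    exact_mod_cast one_le_cornerConst h0 (hA.trans (EuclideanGeometry.angle_le_pi _ _ _))
  have same : ∀ X Y P Q : Plane, segment ℝ X Y ⊆ τ.boundary → P ∈ segment ℝ X Y →
      Q ∈ segment ℝ X Y → setDist τ.boundary P Q ≤ cornerConst α * edist P Q := by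
    intro X Y P Q hXY hP hQ
    calc _ ≤ edist P Q :=
          setDist_le_edist (((convex_segment X Y).segment_subset hP hQ).trans hXY)
      _ = 1 * edist P Q := (one_mul _).symm
      _ ≤ _ := by gcongr
  have hA' := hA.trans_eq (EuclideanGeometry.angle_comm _ _ _)
  have hB' := hB.trans_eq (EuclideanGeometry.angle_comm _ _ _)
  have hC' := hC.trans_eq (EuclideanGeometry.angle_comm _ _ _)
  rintro P ((hP | hP) | hP) Q ((hQ | hQ) | hQ)
  · exact same _ _ P Q hAB hP hQ
  · exact setDist_corner_le h0 hB (segment_symm ℝ τ.A τ.B ▸ hP) hQ hBA hBC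
  · exact setDist_corner_le h0 hA hP (segment_symm ℝ τ.C τ.A ▸ hQ) hAB hAC
  · exact setDist_corner_le h0 hB' hP (segment_symm ℝ τ.A τ.B ▸ hQ) hBC hBA
  · exact same _ _ P Q hBC hP hQ
  · exact setDist_corner_le h0 hC' (segment_symm ℝ τ.B τ.C ▸ hP) hQ hCB hCA
  · exact setDist_corner_le h0 hA' (segment_symm ℝ τ.C τ.A ▸ hP) hQ hAC hAB
  · exact setDist_corner_le h0 hC hP (segment_symm ℝ τ.B τ.C ▸ hQ) hCA hCB
  · exact same _ _ P Q hCA hP hQ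

/-! ### The geometry of one subdivision step -/

open EuclideanGeometry in
lemma linearIndependent_of_angle {X Y Z : Plane} (hX : X ≠ Z) (hY : Y ≠ Z) (h0 : 0 < ∠ X Z Y)
    (hπ : ∠ X Z Y < π) : LinearIndependent ℝ ![X - Z, Y - Z] := by
  rw [LinearIndependent.pair_iff' (sub_ne_zero.2 hX)]
  intro r hr
  rcases lt_trichotomy r 0 with h | h | h
  · have : ∠ X Z Y = π := InnerProductGeometry.angle_eq_pi_iff.2 ⟨sub_ne_zero.2 hX, r, h, hr.symm⟩
    exact hπ.ne this
  · rw [h, zero_smul] at hr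
    exact hY (sub_eq_zero.1 hr.symm)
  · have : ∠ X Z Y = 0 := InnerProductGeometry.angle_eq_zero_iff.2 ⟨sub_ne_zero.2 hX, r, h, hr.symm⟩
    exact h0.ne' this

/-- The numerical constraints on the angles of a tile that can be subdivided. -/
structure AngleTriple (a b c : ℝ) : Prop where
  a_pos : 0 < a
  b_pos : 0 < b
  a_lt_c : a < c
  sum : a + b + c = π

namespace AngleTriple

variable {a b c : ℝ}

lemma conj (h : AngleTriple a b c) : AngleTriple a (c - a) (π - c) :=
  ⟨h.a_pos, by linarith [h.a_lt_c], by linarith [h.sum, h.b_pos], by ring⟩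

lemma c_lt_pi (h : AngleTriple a b c) : c < π := by linarith [h.sum, h.b_pos, h.a_pos]

lemma a_lt_half_pi (h : AngleTriple a b c) : a < π / 2 := by linarith [h.sum, h.b_pos, h.a_lt_c]

lemma sin_a_pos (h : AngleTriple a b c) : 0 < Real.sin a :=
  Real.sin_pos_of_pos_of_lt_pi h.a_pos (by linarith [h.c_lt_pi, h.a_lt_c])

lemma sin_c_pos (h : AngleTriple a b c) : 0 < Real.sin c :=
  Real.sin_pos_of_pos_of_lt_pi (by linarith [h.a_pos, h.a_lt_c]) h.c_lt_pi

lemma cos_a_pos (h : AngleTriple a b c) : 0 < Real.cos a :=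
  Real.cos_pos_of_mem_Ioo ⟨by linarith [h.a_pos, Real.pi_pos], h.a_lt_half_pi⟩

lemma sin_b_lt (h : AngleTriple a b c) : Real.sin b < 2 * Real.cos a * Real.sin c := by
  have hb : b = π - (a + c) := by linarith [h.sum]
  have := Real.sin_pos_of_pos_of_lt_pi (x := c - a) (by linarith [h.a_lt_c])
    (by linarith [h.c_lt_pi, h.a_pos])
  rw [Real.sin_sub] at this
  rw [hb, Real.sin_pi_sub, Real.sin_add]
  linarith

end AngleTriple

/-- The length of `FD` relative to `AB` in the subdivision of a tile with angles `a`, `b`, `c`.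
It has the same value for the conjugate angles `a`, `c - a`, `π - c`. -/
noncomputable def scale (a c : ℝ) : ℝ := (1 - (Real.sin a / Real.sin c) ^ 2) / (2 * Real.cos a)

lemma scale_conj (a c : ℝ) : scale a (π - c) = scale a c := by
  rw [scale, scale, Real.sin_pi_sub]

lemma AngleTriple.scale_pos {a b c : ℝ} (h : AngleTriple a b c) : 0 < scale a c := by
  have hc := h.sin_c_pos
  have h1 := Real.sin_pos_of_pos_of_lt_pi (x := c - a) (by linarith [h.a_lt_c])
    (by linarith [h.c_lt_pi, h.a_pos])
  have h2 := Real.sin_pos_of_pos_of_lt_pi (x := c + a) (by linarith [h.a_lt_c, h.a_pos])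
    (by linarith [h.sum, h.b_pos])
  have h3 : Real.sin a ^ 2 < Real.sin c ^ 2 := by
    have := mul_pos h1 h2
    rw [Real.sin_sub, Real.sin_add] at this
    nlinarith [Real.sin_sq_add_cos_sq a, Real.sin_sq_add_cos_sq c]
  have := h.cos_a_pos
  rw [scale]
  refine div_pos ?_ (by positivity)
  rw [div_pow, sub_pos, div_lt_one (by positivity)]
  exact h3

/-- A tile whose angles at `A`, `B`, `C` are `a`, `b`, `c`. -/
structure Tile.HasAngles (τ : Tile) (a b c : ℝ) : Prop where
  ne : τ.A ≠ τ.B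
  hA : τ.angleA = a
  hB : τ.angleB = b
  hC : τ.angleC = c

namespace Tile

/-- The unit vector from `A` towards `B`. -/
noncomputable def dirB (τ : Tile) : Plane := (dist τ.A τ.B)⁻¹ • (τ.B - τ.A)

/-- The unit vector from `A` towards `C`. -/
noncomputable def dirC (τ : Tile) : Plane := (dist τ.A τ.C)⁻¹ • (τ.C - τ.A)

namespace HasAngles

variable {τ : Tile} {a b c : ℝ}

lemma ne_AC (h : τ.HasAngles a b c) (p : AngleTriple a b c) : τ.A ≠ τ.C := by
  intro e
  have := h.hB
  rw [Tile.angleB, ← e, EuclideanGeometry.angle_self_of_ne h.ne] at this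
  exact p.b_pos.ne this

lemma ne_BC (h : τ.HasAngles a b c) (p : AngleTriple a b c) : τ.B ≠ τ.C := by
  intro e
  have := h.hA
  rw [Tile.angleA, ← e, EuclideanGeometry.angle_self_of_ne h.ne.symm] at this
  exact p.a_pos.ne this

lemma dist_AC (h : τ.HasAngles a b c) : dist τ.A τ.C * Real.sin c = dist τ.A τ.B * Real.sin b := by
  have := EuclideanGeometry.law_sin τ.A τ.B τ.C
  have h2 := EuclideanGeometry.law_sin τ.B τ.C τ.A
  have e : ∠ τ.B τ.C τ.A = c := by rw [EuclideanGeometry.angle_comm]; exact h.hC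
  have e' : ∠ τ.A τ.B τ.C = b := h.hB
  rw [e, e', dist_comm τ.C] at h2
  linarith

/-- The shape of a tile bounds its extent by a multiple of the length of the edge `AB`. -/
lemma region_subset_closedBall (h : τ.HasAngles a b c) (p : AngleTriple a b c) :
    τ.region ⊆ Metric.closedBall τ.A (dist τ.A τ.B / Real.sin c) := by
  have hs := p.sin_c_pos
  refine convexHull_min ?_ (convex_closedBall _ _)
  rintro x (rfl | rfl | rfl)
  · exact Metric.mem_closedBall_self (by positivity)
  · rw [Metric.mem_closedBall, dist_comm, le_div_iff₀ hs]
    exact mul_le_of_le_one_right dist_nonneg (Real.sin_le_one c)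
  · rw [Metric.mem_closedBall, dist_comm, le_div_iff₀ hs, h.dist_AC]
    exact mul_le_of_le_one_right dist_nonneg (Real.sin_le_one b)

lemma norm_dirB (h : τ.HasAngles a b c) : ‖τ.dirB‖ = 1 := by
  rw [Tile.dirB, norm_smul, norm_inv, Real.norm_of_nonneg dist_nonneg, dist_comm, dist_eq_norm]
  exact inv_mul_cancel₀ (norm_ne_zero_iff.2 (sub_ne_zero.2 h.ne.symm))

lemma norm_dirC (h : τ.HasAngles a b c) (p : AngleTriple a b c) : ‖τ.dirC‖ = 1 := by
  rw [Tile.dirC, norm_smul, norm_inv, Real.norm_of_nonneg dist_nonneg, dist_comm, dist_eq_norm]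
  exact inv_mul_cancel₀ (norm_ne_zero_iff.2 (sub_ne_zero.2 (h.ne_AC p).symm))

lemma inner_dirB_dirC (h : τ.HasAngles a b c) (p : AngleTriple a b c) :
    inner ℝ τ.dirB τ.dirC = Real.cos a := by
  rw [Tile.dirB, Tile.dirC, real_inner_smul_left, real_inner_smul_right, ← h.hA, Tile.angleA,
    EuclideanGeometry.angle, InnerProductGeometry.cos_angle, dist_comm, dist_comm τ.A τ.C,
    dist_eq_norm, dist_eq_norm, vsub_eq_sub, vsub_eq_sub]
  have h1 := norm_ne_zero_iff.2 (sub_ne_zero.2 h.ne.symm)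
  have h2 := norm_ne_zero_iff.2 (sub_ne_zero.2 (h.ne_AC p).symm)
  field_simp

end HasAngles

end Tile

/-- The metric description of the five parts of a subdivided tile. -/
structure SplitGeometry (τ : Tile) (a b c : ℝ) (D E F G : Plane) : Prop where
  F_mem : Sbtw ℝ τ.A F τ.B
  D_mem : Sbtw ℝ τ.A D τ.C
  E_mem : Sbtw ℝ τ.A E F
  G_mem : Sbtw ℝ F G τ.C
  tile₁ : Tile.HasAngles ⟨τ.A, D, E⟩ a b c
  tile₂ : Tile.HasAngles ⟨F, D, E⟩ a (c - a) (π - c)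
  tile₃ : Tile.HasAngles ⟨D, F, G⟩ a b c
  tile₄ : Tile.HasAngles ⟨D, τ.C, G⟩ a (c - a) (π - c)
  tile₅ : Tile.HasAngles ⟨τ.C, τ.B, F⟩ a b c
  angle_ADF : ∠ τ.A D F = π - 2 * a
  angle_FDC : ∠ F D τ.C = 2 * a
  angle_AFC : ∠ τ.A F τ.C = π - c
  dist_AF : dist τ.A F = 2 * Real.cos a * dist τ.A D
  dist_FD : dist F D = dist τ.A D
  dist_AD : dist τ.A D = scale a c * dist τ.A τ.B

open EuclideanGeometry in
/-- Every angle follows from the defining ones through angle sums, and every length from the law of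
sines. -/
lemma IsSplit.splitGeometry {τ : Tile} {a b c : ℝ} {D E F G : Plane} (s : IsSplit τ D E F G)
    (h : τ.HasAngles a b c) (p : AngleTriple a b c) : SplitGeometry τ a b c D E F G := by
  obtain ⟨hF, haF, hD, haD, hE, haE, hG, haG⟩ := s
  obtain ⟨A, B, C⟩ := τ
  have hAC := h.ne_AC p
  have hBC := h.ne_BC p
  obtain ⟨hAB, hA, hB, hC⟩ := h
  simp only [Tile.angleA, Tile.angleB, Tile.angleC] at *
  rw [hA] at haF haG
  rw [hB] at haD haE
  have ca := p.cos_a_pos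
  have sa := p.sin_a_pos
  have sc := p.sin_c_pos
  -- the triangle `CBF`
  have x1 : ∠ C B F = b := by
    rw [← hB, hF.symm.angle_eq_right C]; exact angle_comm _ _ _
  have x2 : ∠ B F C = c := by
    have := angle_add_angle_add_angle_eq_pi C hF.ne_right
    linarith [angle_comm F B C, angle_comm B C F, p.sum]
  -- the triangle `AFC`
  have x3 : ∠ A F C = π - c := by
    have := angle_add_angle_eq_pi_of_angle_eq_pi C hF.angle₁₂₃_eq_pi
    linarith [angle_comm C F A, angle_comm C F B]
  have x4 : ∠ F A C = a := by rw [← hA, hF.angle_eq_left C]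
  have x5 : ∠ F C A = c - a := by
    have := angle_add_angle_add_angle_eq_pi C hF.ne_left
    linarith [angle_comm C A F]
  have x6 : ∠ D C F = c - a := by rw [← x5, hD.symm.angle_eq_left F]; exact angle_comm _ _ _
  have x7 : ∠ F D C = 2 * a := by
    have := angle_add_angle_add_angle_eq_pi F hD.ne_right.symm
    linarith [angle_comm C F D, angle_comm C D F, angle_comm F C D, p.sum]
  have x8 : ∠ A D F = π - 2 * a := by
    have := angle_add_angle_eq_pi_of_angle_eq_pi F hD.angle₁₂₃_eq_pi
    linarith [angle_comm F D A]
  have x9 : ∠ D A F = a := by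
    rw [hD.angle_eq_left F, angle_comm]; exact x4
  have x10 : ∠ A F D = a := by
    have := angle_add_angle_add_angle_eq_pi F hD.ne_left
    linarith [angle_comm D F A, angle_comm F A D]
  have hFD : F ≠ D := by
    rintro rfl
    rw [angle_self_of_ne hF.ne_left] at x9
    exact p.a_pos.ne x9
  -- the triangle `ADE`
  have x11 : ∠ D A E = a := by
    rw [hD.angle_eq_left E, angle_comm, hE.angle_eq_left C]; exact hA
  have x12 : ∠ A E D = c := by
    have := angle_add_angle_add_angle_eq_pi E hD.ne_left
    linarith [angle_comm A E D, angle_comm E A D, p.sum]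
  -- lengths
  have l1 : dist A F = 2 * Real.cos a * dist A D := by
    have l := law_sin D F A
    rw [angle_comm D F A, x10, x8, Real.sin_pi_sub,
      Real.sin_two_mul, dist_comm F A] at l
    refine mul_left_cancel₀ sa.ne' ?_
    linarith
  have l2 : dist F D = dist A D := by
    have := law_sin A F D
    rw [x10, x9, dist_comm D A] at this
    exact mul_left_cancel₀ sa.ne' this
  have l3 : dist A E * Real.sin c = dist A D * Real.sin b := by
    have l := law_sin D E A
    rw [angle_comm D E A, x12, haE, dist_comm E A] at l
    linarith
  have l4 : dist A D = scale a c * dist A B := by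
    have l5 := law_sin C F B
    have l6 := law_sin C A B |>.symm
    rw [angle_comm C F B, x2, angle_comm B C F, haF, dist_comm F B] at l5
    rw [angle_comm C A B, hA, angle_comm B C A, hC] at l6
    have l7 := hF.wbtw.dist_add_dist
    have l8 : dist B F = (Real.sin a / Real.sin c) ^ 2 * dist A B := by
      field_simp
      linear_combination Real.sin c * l5 + Real.sin a * l6
    rw [dist_comm F B, l8, l1] at l7
    rw [scale]
    field_simp
    field_simp at l7
    linear_combination l7
  have hEF : Sbtw ℝ A E F := by
    have hlt : dist A E < dist A F := by
      have hAD : 0 < dist A D := dist_pos.2 hD.left_ne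
      rw [l1, ← mul_lt_mul_iff_left₀ sc, l3]
      nlinarith [p.sin_b_lt]
    obtain ⟨⟨e, ⟨he0, he1⟩, rfl⟩, hEA, -⟩ := hE
    obtain ⟨⟨f, ⟨hf0, hf1⟩, rfl⟩, hFA, -⟩ := hF
    rw [dist_left_lineMap, dist_left_lineMap, Real.norm_of_nonneg he0, Real.norm_of_nonneg hf0]
      at hlt
    have hef : e < f := lt_of_mul_lt_mul_right hlt dist_nonneg
    have hf0' : 0 < f := he0.trans_lt hef
    refine ⟨⟨e / f, ⟨by positivity, (div_le_one hf0').2 hef.le⟩, ?_⟩, hEA, ?_⟩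
    · rw [AffineMap.lineMap_lineMap_right, div_mul_cancel₀ _ hf0'.ne']
    · intro heq
      exact hef.ne ((AffineMap.lineMap_injective ℝ hAB) heq)
  have x13 : ∠ D F E = a := by
    rw [← x10, hEF.symm.angle_eq_right D]; exact angle_comm _ _ _
  have x14 : ∠ F E D = π - c := by
    have := angle_add_angle_eq_pi_of_angle_eq_pi D hEF.angle₁₂₃_eq_pi
    linarith [angle_comm D E A, angle_comm D E F]
  have x15 : ∠ F D E = c - a := by
    have := angle_add_angle_add_angle_eq_pi E hFD.symm
    linarith [angle_comm D E F, angle_comm E F D]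
  -- the triangles `DCG` and `DFG`
  have x16 : ∠ D C G = c - a := by rw [← x6]; exact hG.angle_eq_right D
  have x17 : ∠ D G C = π - c := by
    have := angle_add_angle_add_angle_eq_pi G hD.ne_right.symm
    linarith [angle_comm C G D, angle_comm G D C]
  have x18 : ∠ D G F = c := by
    have := angle_add_angle_eq_pi_of_angle_eq_pi D hG.angle₁₂₃_eq_pi
    linarith
  have x19 : ∠ D F G = b := by rw [← haD]; exact hG.symm.angle_eq_right D
  have x20 : ∠ F D G = a := by
    have := angle_add_angle_add_angle_eq_pi G hFD
    linarith [angle_comm F G D, angle_comm G D F, p.sum]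
  exact {
    F_mem := hF
    D_mem := hD
    E_mem := hEF
    G_mem := hG.symm
    tile₁ := ⟨hD.left_ne, x11, haE, x12⟩
    tile₂ := ⟨hFD, x13, x15, x14⟩
    tile₃ := ⟨hFD.symm, x20, x19, x18⟩
    tile₄ := ⟨hD.ne_right, by rw [← haG]; exact angle_comm _ _ _, x16, x17⟩
    tile₅ := ⟨hBC.symm, by rw [← haF]; exact angle_comm _ _ _, x1,
      by rw [← x2]; exact angle_comm _ _ _⟩
    angle_ADF := x8
    angle_FDC := x7
    angle_AFC := x3
    dist_AF := l1
    dist_FD := l2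
    dist_AD := l4 }

lemma sub_eq_dist_smul_of_sbtw {X M Y : Plane} (h : Sbtw ℝ X M Y) :
    M - X = dist X M • ((dist X Y)⁻¹ • (Y - X)) := by
  have hXY := dist_ne_zero.2 h.left_ne_right
  obtain ⟨⟨t, ⟨ht0, ht1⟩, rfl⟩, -⟩ := h
  rw [dist_left_lineMap, Real.norm_of_nonneg ht0, smul_smul, mul_assoc, mul_inv_cancel₀ hXY,
    mul_one, AffineMap.lineMap_apply, vsub_eq_sub, vadd_eq_add, add_sub_cancel_right]

lemma mem_segment_or_mem_segment {X M Y x : Plane} (h : Wbtw ℝ X M Y) (hx : x ∈ segment ℝ X Y) :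
    x ∈ segment ℝ X M ∨ x ∈ segment ℝ M Y := by
  rw [mem_segment_iff_wbtw] at hx ⊢
  rw [mem_segment_iff_wbtw]
  obtain ⟨t, ⟨ht0, ht1⟩, rfl⟩ := h
  obtain ⟨r, ⟨hr0, hr1⟩, rfl⟩ := id hx
  rcases le_total r t with hrt | hrt
  · exact Or.inl (wbtw_smul_vadd_smul_vadd_of_nonneg_of_le X (Y - X) hr0 hrt)
  · exact Or.inr (hx.trans_left_right
      (wbtw_smul_vadd_smul_vadd_of_nonneg_of_le X (Y - X) ht0 hrt))

namespace SplitGeometry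

variable {τ : Tile} {a b c : ℝ} {D E F G : Plane}

lemma dirC_tile₂ (g : SplitGeometry τ a b c D E F G) : (⟨F, D, E⟩ : Tile).dirC = -τ.dirB := by
  have h1 := sub_eq_dist_smul_of_sbtw g.E_mem.symm
  have h2 := sub_eq_dist_smul_of_sbtw g.F_mem
  have hFE := dist_ne_zero.2 g.E_mem.ne_right.symm
  have hAF := dist_ne_zero.2 g.F_mem.left_ne
  rw [Tile.dirC, Tile.dirB, h1, smul_smul, inv_mul_cancel₀ hFE, one_smul, ← neg_sub F, h2,
    smul_neg, dist_comm F, smul_smul, inv_mul_cancel₀ hAF, one_smul]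

/-- In the isosceles triangle `AFD`, the direction of `FD` is obtained from the directions of the
edges at `A`. Together with `dirC_tile₂` this says that the directions of the edges at the first
vertex of the child `FDE` are those at `A` turned by the angle `a`, up to a half turn. The turn is
away from the edge `AC`; as the new edge `AC` points back along the old edge `AB`, repeated turns
have the same sense. -/
lemma dirB_tile₂ (g : SplitGeometry τ a b c D E F G) :
    (⟨F, D, E⟩ : Tile).dirB = τ.dirC - (2 * Real.cos a) • τ.dirB := by
  have h1 := sub_eq_dist_smul_of_sbtw g.D_mem
  have h2 := sub_eq_dist_smul_of_sbtw g.F_mem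
  have hAD := dist_ne_zero.2 g.D_mem.left_ne
  have e : D - F = dist τ.A D • (τ.dirC - (2 * Real.cos a) • τ.dirB) := by
    rw [smul_sub, smul_smul, mul_comm (dist τ.A D), ← g.dist_AF, Tile.dirC, Tile.dirB, ← h1, ← h2,
      sub_sub_sub_cancel_right]
  rw [Tile.dirB, g.dist_FD, e, smul_smul, inv_mul_cancel₀ hAD, one_smul]

lemma region_eq (g : SplitGeometry τ a b c D E F G) :
    τ.region = Tile.region ⟨τ.A, D, E⟩ ∪ Tile.region ⟨F, D, E⟩ ∪ Tile.region ⟨D, F, G⟩ ∪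
      Tile.region ⟨D, τ.C, G⟩ ∪ Tile.region ⟨τ.C, τ.B, F⟩ := by
  have c1 := convexHull_cevian_union (Z := τ.C) g.F_mem.wbtw
  have c2 := convexHull_cevian_union (Z := F) g.D_mem.wbtw
  have c3 := convexHull_cevian_union (Z := D) g.E_mem.wbtw
  have c4 := convexHull_cevian_union (Z := D) g.G_mem.wbtw
  simp only [Tile.region]
  rw [Set.insert_comm τ.A D {E}, Set.insert_comm F D {E}, c3, Set.union_assoc (convexHull ℝ _), c4]
  rw [Set.insert_comm D τ.A, Set.pair_comm D F, Set.insert_comm τ.A F, Set.insert_comm D F,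
    Set.pair_comm D τ.C, c2, Set.insert_comm F τ.A, Set.pair_comm F τ.C, Set.insert_comm τ.A τ.C,
    c1, Set.insert_comm τ.C τ.A, Set.pair_comm τ.C τ.B]

lemma boundary_subset (g : SplitGeometry τ a b c D E F G) :
    τ.boundary ⊆ Tile.boundary ⟨τ.A, D, E⟩ ∪ Tile.boundary ⟨F, D, E⟩ ∪ Tile.boundary ⟨D, F, G⟩ ∪
      Tile.boundary ⟨D, τ.C, G⟩ ∪ Tile.boundary ⟨τ.C, τ.B, F⟩ := by
  simp only [Tile.boundary]
  rintro x ((hx | hx) | hx)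
  · rcases mem_segment_or_mem_segment g.F_mem.wbtw hx with hx | hx
    · rcases mem_segment_or_mem_segment g.E_mem.wbtw hx with hx | hx
      · rw [segment_symm] at hx
        exact Or.inl (Or.inl (Or.inl (Or.inl (Or.inr hx))))
      · exact Or.inl (Or.inl (Or.inl (Or.inr (Or.inr hx))))
    · rw [segment_symm] at hx
      exact Or.inr (Or.inl (Or.inr hx))
  · rw [segment_symm] at hx
    exact Or.inr (Or.inl (Or.inl hx))
  · rw [segment_symm] at hx
    rcases mem_segment_or_mem_segment g.D_mem.wbtw hx with hx | hx
    · exact Or.inl (Or.inl (Or.inl (Or.inl (Or.inl (Or.inl hx)))))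
    · exact Or.inl (Or.inr (Or.inl (Or.inl hx)))

/-- The chord bound passes from the parts of a subdivided tile to the whole: the parts are glued
along the cevians `DE`, `DG`, `FD` and `CF`. -/
lemma chordBound_union {K : ℝ≥0∞} {X₁ X₂ X₃ X₄ X₅ : Set Plane} (g : SplitGeometry τ a b c D E F G)
    (p : AngleTriple a b c)
    (h₁ : ChordBound K X₁) (h₂ : ChordBound K X₂) (h₃ : ChordBound K X₃) (h₄ : ChordBound K X₄)
    (h₅ : ChordBound K X₅)
    (b₁ : Tile.boundary ⟨τ.A, D, E⟩ ⊆ X₁) (b₂ : Tile.boundary ⟨F, D, E⟩ ⊆ X₂)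
    (b₃ : Tile.boundary ⟨D, F, G⟩ ⊆ X₃) (b₄ : Tile.boundary ⟨D, τ.C, G⟩ ⊆ X₄)
    (b₅ : Tile.boundary ⟨τ.C, τ.B, F⟩ ⊆ X₅)
    (r₁ : X₁ ⊆ Tile.region ⟨τ.A, D, E⟩) (r₂ : X₂ ⊆ Tile.region ⟨F, D, E⟩)
    (r₃ : X₃ ⊆ Tile.region ⟨D, F, G⟩) (r₄ : X₄ ⊆ Tile.region ⟨D, τ.C, G⟩)
    (r₅ : X₅ ⊆ Tile.region ⟨τ.C, τ.B, F⟩)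
    (hC : ∠ τ.A τ.C τ.B = c) (hBC : τ.B ≠ τ.C) :
    ChordBound K (X₁ ∪ X₂ ∪ X₃ ∪ X₄ ∪ X₅) := by
  have c1 := convexHull_cevian_union (Z := τ.C) g.F_mem.wbtw
  have c2 := convexHull_cevian_union (Z := F) g.D_mem.wbtw
  have c3 := convexHull_cevian_union (Z := D) g.E_mem.wbtw
  have c4 := convexHull_cevian_union (Z := D) g.G_mem.wbtw
  have ha := p.a_pos
  have hπ := p.a_lt_half_pi
  have hac := p.a_lt_c
  have hcπ := p.c_lt_pi
  have i1 := convexHull_cevian_inter (Z := τ.C) g.F_mem (linearIndependent_of_angle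
    g.D_mem.left_ne_right hBC (by linarith) (by linarith))
  have i2 := convexHull_cevian_inter (Z := F) g.D_mem (linearIndependent_of_angle
    g.F_mem.left_ne (g.tile₅.ne_AC p) (by linarith [g.angle_AFC]) (by linarith [g.angle_AFC]))
  have i3 := convexHull_cevian_inter (Z := D) g.E_mem (linearIndependent_of_angle
    g.D_mem.left_ne g.tile₂.ne (by linarith [g.angle_ADF]) (by linarith [g.angle_ADF]))
  have i4 := convexHull_cevian_inter (Z := D) g.G_mem (linearIndependent_of_angle
    g.tile₂.ne g.D_mem.right_ne (by linarith [g.angle_FDC]) (by linarith [g.angle_FDC]))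
  have e1 : Tile.region ⟨τ.A, D, E⟩ = convexHull ℝ {D, τ.A, E} := by
    rw [Tile.region, Set.insert_comm]
  have e2 : Tile.region ⟨F, D, E⟩ = convexHull ℝ {D, F, E} := by
    rw [Tile.region, Set.insert_comm]
  have e6 : convexHull ℝ {D, τ.A, F} = convexHull ℝ {F, τ.A, D} := by
    rw [Set.insert_comm D, Set.pair_comm D, Set.insert_comm τ.A]
  have e7 : convexHull ℝ {D, F, τ.C} = convexHull ℝ {F, τ.C, D} := by
    rw [Set.insert_comm D, Set.pair_comm D]
  have e8 : convexHull ℝ {F, τ.A, τ.C} = convexHull ℝ {τ.C, τ.A, F} := by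
    rw [Set.insert_comm F, Set.pair_comm F, Set.insert_comm τ.A]
  rw [e1] at r₁
  rw [e2] at r₂
  have cv := fun X Y Z : Plane => convex_convexHull ℝ ({X, Y, Z} : Set Plane)
  have h12 : ChordBound K (X₁ ∪ X₂) := by
    refine h₁.union h₂ r₁ r₂ (isClosed_convexHull_triple ..) (isClosed_convexHull_triple ..)
      (c3 ▸ cv _ _ _) (i3.trans fun x hx => ⟨b₁ (Or.inl (Or.inr hx)), b₂ (Or.inl (Or.inr hx))⟩)
  have r12 := Set.union_subset_union r₁ r₂
  rw [c3, e6] at r12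
  have h34 : ChordBound K (X₃ ∪ X₄) := by
    refine h₃.union h₄ r₃ r₄ (isClosed_convexHull_triple ..) (isClosed_convexHull_triple ..)
      (c4 ▸ cv _ _ _) (i4.trans fun x hx => ?_)
    rw [segment_symm] at hx
    exact ⟨b₃ (Or.inr hx), b₄ (Or.inr hx)⟩
  have r34 := Set.union_subset_union r₃ r₄
  rw [Tile.region, Tile.region, c4, e7] at r34
  have h1234 : ChordBound K (X₁ ∪ X₂ ∪ (X₃ ∪ X₄)) := by
    refine h12.union h34 r12 r34 (isClosed_convexHull_triple ..) (isClosed_convexHull_triple ..)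
      (c2 ▸ cv _ _ _) (i2.trans fun x hx => ⟨Or.inr (b₂ (Or.inl (Or.inl hx))), ?_⟩)
    rw [segment_symm] at hx
    exact Or.inl (b₃ (Or.inl (Or.inl hx)))
  have r1234 := Set.union_subset_union r12 r34
  rw [c2, e8] at r1234
  rw [Set.union_assoc (X₁ ∪ X₂)]
  refine h1234.union h₅ r1234 r₅ (isClosed_convexHull_triple ..) (isClosed_convexHull_triple ..)
      (c1 ▸ cv _ _ _) (i1.trans fun x hx => ?_)
  rw [segment_symm] at hx
  refine ⟨Or.inr ?_, b₅ (Or.inr hx)⟩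
  rcases mem_segment_or_mem_segment g.G_mem.wbtw hx with hx | hx
  · exact Or.inl (b₃ (Or.inl (Or.inr hx)))
  · rw [segment_symm] at hx
    exact Or.inr (b₄ (Or.inl (Or.inr hx)))

end SplitGeometry

/-! ### Tilings -/

/-- The two shapes of tiles in a tiling of a triangle with angles `a`, `b`, `c`: similar to that
triangle, or to its conjugate. -/
def IsShape (a b c : ℝ) (τ : Tile) : Prop :=
  τ.HasAngles a b c ∨ τ.HasAngles a (c - a) (π - c)

lemma IsShape.split {a b c : ℝ} (p : AngleTriple a b c) {τ : Tile} (h : IsShape a b c τ)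
    {D E F G : Plane} (s : IsSplit τ D E F G) :
    (∃ b' c', AngleTriple a b' c' ∧ τ.HasAngles a b' c' ∧ SplitGeometry τ a b' c' D E F G ∧
      scale a c' = scale a c) ∧
    IsShape a b c ⟨τ.A, D, E⟩ ∧ IsShape a b c ⟨F, D, E⟩ ∧ IsShape a b c ⟨D, F, G⟩ ∧
      IsShape a b c ⟨D, τ.C, G⟩ ∧ IsShape a b c ⟨τ.C, τ.B, F⟩ := by
  rcases h with h | h
  · have g := s.splitGeometry h p
    exact ⟨⟨b, c, p, h, g, rfl⟩, Or.inl g.tile₁, Or.inr g.tile₂, Or.inl g.tile₃, Or.inr g.tile₄,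
      Or.inl g.tile₅⟩
  · have g := s.splitGeometry h p.conj
    have e : π - c - a = b := by linarith [p.sum]
    have h2 := g.tile₂
    have h4 := g.tile₄
    rw [e, sub_sub_cancel] at h2 h4
    exact ⟨⟨_, _, p.conj, h, g, scale_conj a c⟩, Or.inr g.tile₁, Or.inl h2, Or.inr g.tile₃,
      Or.inl h4, Or.inr g.tile₅⟩

lemma skeleton_union (S S' : Set Tile) : skeleton (S ∪ S') = skeleton S ∪ skeleton S' :=
  Set.biUnion_union S S' _

lemma skeleton_singleton (τ : Tile) : skeleton {τ} = τ.boundary := Set.biUnion_singleton τ _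

lemma Tile.boundary_subset_region (τ : Tile) : τ.boundary ⊆ τ.region := by
  have hA : τ.A ∈ τ.region := subset_convexHull ℝ _ (by simp)
  have hB : τ.B ∈ τ.region := subset_convexHull ℝ _ (by simp)
  have hC : τ.C ∈ τ.region := subset_convexHull ℝ _ (by simp)
  have hc : Convex ℝ τ.region := convex_convexHull ℝ _
  exact Set.union_subset (Set.union_subset (hc.segment_subset hA hB) (hc.segment_subset hB hC))
    (hc.segment_subset hC hA)

namespace IsTiling

variable {a b c : ℝ} {τ : Tile} {R : Set Tile}

lemma isShape (p : AngleTriple a b c) (hR : IsTiling τ R) (h : IsShape a b c τ) :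
    ∀ ρ ∈ R, IsShape a b c ρ := by
  induction hR with
  | root T => rintro ρ rfl; exact h
  | split T D E F G s S₁ S₂ S₃ S₄ S₅ _ _ _ _ _ i₁ i₂ i₃ i₄ i₅ =>
    obtain ⟨-, k₁, k₂, k₃, k₄, k₅⟩ := h.split p s
    rintro ρ ((((hρ | hρ) | hρ) | hρ) | hρ)
    exacts [i₁ k₁ ρ hρ, i₂ k₂ ρ hρ, i₃ k₃ ρ hρ, i₄ k₄ ρ hρ, i₅ k₅ ρ hρ]

lemma boundary_subset_skeleton (p : AngleTriple a b c) (hR : IsTiling τ R)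
    (h : IsShape a b c τ) : τ.boundary ⊆ skeleton R := by
  induction hR with
  | root T => rw [skeleton_singleton]
  | split T D E F G s S₁ S₂ S₃ S₄ S₅ _ _ _ _ _ i₁ i₂ i₃ i₄ i₅ =>
    obtain ⟨⟨b', c', -, -, g, -⟩, k₁, k₂, k₃, k₄, k₅⟩ := h.split p s
    simp only [skeleton_union]
    exact g.boundary_subset.trans (Set.union_subset_union (Set.union_subset_union
      (Set.union_subset_union (Set.union_subset_union (i₁ k₁) (i₂ k₂)) (i₃ k₃)) (i₄ k₄)) (i₅ k₅))

lemma biUnion_region (p : AngleTriple a b c) (hR : IsTiling τ R) (h : IsShape a b c τ) :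
    ⋃ ρ ∈ R, ρ.region = τ.region := by
  induction hR with
  | root T => exact Set.biUnion_singleton T _
  | split T D E F G s S₁ S₂ S₃ S₄ S₅ _ _ _ _ _ i₁ i₂ i₃ i₄ i₅ =>
    obtain ⟨⟨b', c', -, -, g, -⟩, k₁, k₂, k₃, k₄, k₅⟩ := h.split p s
    simp only [Set.biUnion_union]
    rw [i₁ k₁, i₂ k₂, i₃ k₃, i₄ k₄, i₅ k₅, g.region_eq]

lemma skeleton_subset_region (p : AngleTriple a b c) (hR : IsTiling τ R) (h : IsShape a b c τ) :
    skeleton R ⊆ τ.region := by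
  rw [← hR.biUnion_region p h]
  exact Set.iUnion₂_mono fun ρ _ => ρ.boundary_subset_region

/-- The chord bound holds in all tilings of tiles of the two shapes, with a constant that only
depends on the smallest angle. -/
lemma chordBound {α : ℝ} (p : AngleTriple a b c) (hα : 0 < α) (ha : α ≤ a) (hb : α ≤ b)
    (hb' : α ≤ c - a) (hR : IsTiling τ R) (h : IsShape a b c τ) :
    ChordBound (cornerConst α) (skeleton R) := by
  induction hR with
  | root T =>
    rw [skeleton_singleton]
    have := p.a_lt_c
    rcases h with h | h
    · exact chordBound_boundary hα (by rw [h.hA]; exact ha) (by rw [h.hB]; exact hb)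
        (by rw [h.hC]; linarith)
    · exact chordBound_boundary hα (by rw [h.hA]; exact ha) (by rw [h.hB]; exact hb')
        (by rw [h.hC]; linarith [p.sum, p.a_pos])
  | split T D E F G s S₁ S₂ S₃ S₄ S₅ t₁ t₂ t₃ t₄ t₅ i₁ i₂ i₃ i₄ i₅ =>
    obtain ⟨⟨b', c', p', hT, g, -⟩, k₁, k₂, k₃, k₄, k₅⟩ := h.split p s
    simp only [skeleton_union]
    exact g.chordBound_union p' (i₁ k₁) (i₂ k₂) (i₃ k₃) (i₄ k₄) (i₅ k₅)
      (t₁.boundary_subset_skeleton p k₁) (t₂.boundary_subset_skeleton p k₂)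
      (t₃.boundary_subset_skeleton p k₃) (t₄.boundary_subset_skeleton p k₄)
      (t₅.boundary_subset_skeleton p k₅)
      (t₁.skeleton_subset_region p k₁) (t₂.skeleton_subset_region p k₂)
      (t₃.skeleton_subset_region p k₃) (t₄.skeleton_subset_region p k₄)
      (t₅.skeleton_subset_region p k₅) hT.hC (hT.ne_BC p')

/-- Tilings of the tiles of a tiling combine to a tiling. -/
lemma trans (hR : IsTiling τ R) {S : Set Tile} (h : ∀ ρ ∈ R, ∃ R' ⊆ S, IsTiling ρ R') :
    ∃ R' ⊆ S, IsTiling τ R' := by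
  induction hR with
  | root T => exact h T rfl
  | split T D E F G s S₁ S₂ S₃ S₄ S₅ _ _ _ _ _ i₁ i₂ i₃ i₄ i₅ =>
    obtain ⟨R₁, u₁, v₁⟩ := i₁ fun ρ hρ => h ρ (Or.inl (Or.inl (Or.inl (Or.inl hρ))))
    obtain ⟨R₂, u₂, v₂⟩ := i₂ fun ρ hρ => h ρ (Or.inl (Or.inl (Or.inl (Or.inr hρ))))
    obtain ⟨R₃, u₃, v₃⟩ := i₃ fun ρ hρ => h ρ (Or.inl (Or.inl (Or.inr hρ)))
    obtain ⟨R₄, u₄, v₄⟩ := i₄ fun ρ hρ => h ρ (Or.inl (Or.inr hρ))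
    obtain ⟨R₅, u₅, v₅⟩ := i₅ fun ρ hρ => h ρ (Or.inr hρ)
    exact ⟨_, Set.union_subset (Set.union_subset (Set.union_subset (Set.union_subset u₁ u₂) u₃)
      u₄) u₅, IsTiling.split T D E F G s R₁ R₂ R₃ R₄ R₅ v₁ v₂ v₃ v₄ v₅⟩

end IsTiling

lemma Refines.trans {S S' S'' : Set Tile} (h : Refines S' S) (h' : Refines S'' S') :
    Refines S'' S := by
  intro τ hτ
  obtain ⟨R, hRS, hR⟩ := h τ hτ
  exact hR.trans fun ρ hρ => h' ρ (hRS hρ)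

/-! ### Directions of edges -/

/-- The passage from the pair of directions `(dirB, dirC)` of a tile to the pair of its child
`FDE`. -/
noncomputable def turn (a : ℝ) (x : Plane × Plane) : Plane × Plane :=
  (x.2 - (2 * Real.cos a) • x.1, -x.1)

lemma segment_AB_subset_boundary (τ : Tile) : segment ℝ τ.A τ.B ⊆ τ.boundary :=
  fun _ hx => Or.inl (Or.inl hx)

/-- If all tiles of a tiling are small enough, then its skeleton contains the edge `AB` of the tile
that is obtained by passing `k` times to the child `FDE`. -/
lemma IsTiling.exists_edge {a b c : ℝ} (p : AngleTriple a b c) (k : ℕ) {τ : Tile} {R : Set Tile}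
    (hR : IsTiling τ R) (h : IsShape a b c τ)
    (hsmall : ∀ ρ ∈ R, ∀ j ≤ k, dist ρ.A ρ.B < scale a c ^ j * dist τ.A τ.B) :
    ∃ q r : Plane, segment ℝ q r ⊆ skeleton R ∧ q ∈ τ.region ∧ r ∈ τ.region ∧
      dist q r = scale a c ^ k * dist τ.A τ.B ∧
      r - q = (scale a c ^ k * dist τ.A τ.B) • ((turn a)^[k] (τ.dirB, τ.dirC)).1 := by
  induction k generalizing τ R with
  | zero =>
    refine ⟨τ.A, τ.B, (segment_AB_subset_boundary τ).trans (hR.boundary_subset_skeleton p h),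
      subset_convexHull ℝ _ (by simp), subset_convexHull ℝ _ (by simp), by simp, ?_⟩
    have hne : dist τ.A τ.B ≠ 0 := dist_ne_zero.2 (h.elim (fun h => h.ne) (fun h => h.ne))
    simp [Tile.dirB, smul_smul, mul_inv_cancel₀ hne]
  | succ k ih =>
    cases hR with
    | root => exact absurd (hsmall τ rfl 0 (Nat.zero_le _)) (by simp)
    | split _ D E F G s S₁ S₂ S₃ S₄ S₅ t₁ t₂ t₃ t₄ t₅ =>
      obtain ⟨⟨b', c', -, -, g, hsc⟩, -, k₂, -⟩ := h.split p s
      have hd : dist F D = scale a c * dist τ.A τ.B := by rw [g.dist_FD, g.dist_AD, hsc]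
      obtain ⟨q, r, hqr, hq, hr, hdist, e⟩ := ih t₂ k₂ fun ρ hρ j hj => by
        have := hsmall ρ (Or.inl (Or.inl (Or.inl (Or.inr hρ)))) (j + 1) (by omega)
        rwa [pow_succ, mul_assoc, ← hd] at this
      have hreg : Tile.region ⟨F, D, E⟩ ⊆ τ.region := by
        rw [g.region_eq]
        exact fun x hx => Or.inl (Or.inl (Or.inl (Or.inr hx)))
      refine ⟨q, r, ?_, hreg hq, hreg hr, by rw [hdist, hd, pow_succ, mul_assoc], ?_⟩
      · simp only [skeleton_union]
        exact fun x hx => Or.inl (Or.inl (Or.inl (Or.inr (hqr hx))))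
      · rw [e, g.dirB_tile₂, g.dirC_tile₂, Function.iterate_succ_apply, turn, pow_succ, mul_assoc,
          ← hd]

/-- In the plane, the coordinates of `v` with respect to unit vectors `u` and `w` at the angle `a`
are values of the cosine. -/
lemma exists_phase {a : ℝ} (ha : Real.sin a ≠ 0) {u w : Plane} (hu : ‖u‖ = 1) (hw : ‖w‖ = 1)
    (huw : inner ℝ u w = Real.cos a) (v : Plane) :
    ∃ φ : ℝ, inner ℝ v u = ‖v‖ * Real.cos φ ∧ inner ℝ v w = ‖v‖ * Real.cos (φ - a) := by
  have hu2 : u 0 ^ 2 + u 1 ^ 2 = 1 := by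
    have := EuclideanSpace.real_norm_sq_eq u
    rw [hu, Fin.sum_univ_two] at this
    linarith
  have hw2 : w 0 ^ 2 + w 1 ^ 2 = 1 := by
    have := EuclideanSpace.real_norm_sq_eq w
    rw [hw, Fin.sum_univ_two] at this
    linarith
  have hv2 : ‖v‖ ^ 2 = v 0 ^ 2 + v 1 ^ 2 := by
    rw [EuclideanSpace.real_norm_sq_eq, Fin.sum_univ_two]
  have hin : ∀ x y : Plane, inner ℝ x y = x 0 * y 0 + x 1 * y 1 := by
    intro x y
    simp [PiLp.inner_apply, Fin.sum_univ_two, mul_comm]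
  have hsc := Real.sin_sq_add_cos_sq a
  rw [hin] at huw
  set s := inner ℝ v u with hs
  set q := (inner ℝ v w - s * Real.cos a) / Real.sin a with hq
  have hq' : inner ℝ v w = s * Real.cos a + q * Real.sin a := by
    rw [hq, div_mul_cancel₀ _ ha]; ring
  have hnorm : ‖(⟨s, q⟩ : ℂ)‖ = ‖v‖ := by
    have h1 : ‖(⟨s, q⟩ : ℂ)‖ ^ 2 = ‖v‖ ^ 2 := by
      rw [Complex.sq_norm, Complex.normSq_mk, hv2]
      have hs1 : Real.sin a ^ 2 * (s * s + q * q - (v 0 ^ 2 + v 1 ^ 2)) = 0 := by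
        have hqs : q * Real.sin a = inner ℝ v w - s * Real.cos a := by rw [hq']; ring
        have : Real.sin a ^ 2 * (s * s + q * q - (v 0 ^ 2 + v 1 ^ 2)) =
          Real.sin a ^ 2 * (s * s - (v 0 ^ 2 + v 1 ^ 2)) + (q * Real.sin a) ^ 2 := by ring
        rw [this, hqs, hs, hin, hin]
        rw [← huw] at hsc ⊢
        linear_combination ((v 0 * u 0 + v 1 * u 1) ^ 2 - (v 0 ^ 2 + v 1 ^ 2)) * hsc
          + ((v 0 ^ 2 + v 1 ^ 2) * (u 0 ^ 2 + u 1 ^ 2) - (v 0 * u 0 + v 1 * u 1) ^ 2) * hw2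
          + ((v 0 ^ 2 + v 1 ^ 2) - (v 0 * w 0 + v 1 * w 1) ^ 2) * hu2
      have := (mul_eq_zero.1 hs1).resolve_left (pow_ne_zero 2 ha)
      linarith
    exact (pow_left_inj₀ (norm_nonneg _) (norm_nonneg _) two_ne_zero).1 h1
  refine ⟨Complex.arg ⟨s, q⟩, ?_, ?_⟩
  · rw [← hnorm, Complex.norm_mul_cos_arg]
  · rw [Real.cos_sub, mul_add, ← mul_assoc, ← mul_assoc, ← hnorm, Complex.norm_mul_cos_arg,
      Complex.norm_mul_sin_arg, hq']

lemma abs_inner_turn_iterate {a φ : ℝ} {u w v : Plane} (hu : inner ℝ v u = ‖v‖ * Real.cos φ)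
    (hw : inner ℝ v w = ‖v‖ * Real.cos (φ - a)) (k : ℕ) :
    |inner ℝ v ((turn a)^[k] (u, w)).1| = ‖v‖ * |Real.cos (φ + k * a)| := by
  have key : inner ℝ v ((turn a)^[k] (u, w)).1 = (-1) ^ k * (‖v‖ * Real.cos (φ + k * a)) ∧
      inner ℝ v ((turn a)^[k] (u, w)).2 = (-1) ^ k * (‖v‖ * Real.cos (φ + k * a - a)) := by
    induction k with
    | zero => simp [hu, hw]
    | succ k ih =>
      rw [Function.iterate_succ_apply', turn, inner_sub_right, inner_smul_right, inner_neg_right,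
        ih.1, ih.2]
      have e : φ + ((k + 1 : ℕ) : ℝ) * a = φ + k * a + a := by push_cast; ring
      rw [e, add_sub_cancel_right]
      generalize φ + k * a = x
      rw [Real.cos_add, Real.cos_sub]
      constructor <;> ring
  rw [key.1, abs_mul, abs_mul, abs_pow, abs_neg, abs_one, one_pow, one_mul, abs_norm]

/-- As `a / π` is irrational, the multiples of `a` are dense modulo `π`, and by compactness
boundedly many of them suffice to come close to every angle. -/
lemma exists_uniform_cos {a : ℝ} (ha : Irrational (a / π)) {ε : ℝ} (hε : 0 < ε) :
    ∃ N : ℕ, ∀ φ : ℝ, ∃ k ≤ N, 1 - ε ≤ |Real.cos (φ + k * a)| := by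
  have hd := dense_addSubgroupClosure_pair_iff.2 ha
  let V : ℤ → Set ℝ := fun n => {φ | 1 - ε < |Real.cos (φ + n * a)|}
  have hV : ∀ n, IsOpen (V n) := fun n => isOpen_lt continuous_const (by fun_prop)
  have hcover : Set.Icc 0 π ⊆ ⋃ n, V n := by
    intro φ _
    obtain ⟨y, hy, hyc⟩ := hd.exists_mem_open
      (isOpen_lt continuous_const (by fun_prop) : IsOpen {y : ℝ | 1 - ε < |Real.cos (φ + y)|})
      ⟨-φ, by simpa using hε⟩
    obtain ⟨n, l, rfl⟩ := AddSubgroup.mem_closure_pair.1 hy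
    refine Set.mem_iUnion.2 ⟨n, ?_⟩
    have e : φ + (n • a + l • π) = φ + n * a + l * π := by simp [add_assoc]
    rw [Set.mem_ofPred_eq, e, Real.cos_add_int_mul_pi, abs_mul, abs_zpow, abs_neg, abs_one,
      one_zpow, one_mul] at hyc
    exact hyc
  obtain ⟨t, ht⟩ := isCompact_Icc.elim_finite_subcover V hV hcover
  obtain ⟨M, hM⟩ : ∃ M : ℕ, ∀ n ∈ t, n.natAbs ≤ M :=
    ⟨t.sup Int.natAbs, fun n hn => Finset.le_sup (f := Int.natAbs) hn⟩
  refine ⟨2 * M, fun φ => ?_⟩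
  -- integer multiples are turned into natural ones by starting at the `M`-th multiple
  have hper : Function.Periodic (fun φ (n : ℤ) => |Real.cos (φ + n * a)|) π := by
    intro φ
    funext n
    change |Real.cos (φ + π + n * a)| = |Real.cos (φ + n * a)|
    rw [add_right_comm, Real.cos_add_pi, abs_neg]
  obtain ⟨ψ, hψ, hψe⟩ := hper.exists_mem_Ico₀ Real.pi_pos (φ + M * a)
  obtain ⟨n, hn, hnV⟩ := Set.mem_iUnion₂.1 (ht (Set.Ico_subset_Icc_self hψ))
  have h1 := congrFun hψe n
  have h2 := hM n hn
  refine ⟨(M + n).toNat, by omega, ?_⟩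
  have h3 : (((M + n).toNat : ℕ) : ℝ) = M + n := by
    have : (((M + n).toNat : ℕ) : ℤ) = M + n := Int.toNat_of_nonneg (by omega)
    exact_mod_cast this
  rw [h3, add_mul, ← add_assoc]
  exact (h1.symm ▸ hnV : 1 - ε < |Real.cos (φ + M * a + n * a)|).le

/-! ### Lipschitz functions with small gradient -/

open MeasureTheory in
/-- A Lipschitz function whose gradient has norm at most `1` almost everywhere on a convex body
is `1`-Lipschitz there. By Fubini almost every line in a given direction meets the exceptional
null set in a null set, and on such a line the function is the integral of its derivative. -/
lemma abs_sub_le_of_ae_norm_fderiv_le {E : Type*} [NormedAddCommGroup E] [NormedSpace ℝ E]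
    [FiniteDimensional ℝ E] [MeasurableSpace E] [BorelSpace E] (μ : Measure E) [μ.IsAddHaarMeasure]
    {K : NNReal} {g : E → ℝ} (hg : LipschitzWith K g) {R : Set E} (hR : Convex ℝ R)
    (hint : (interior R).Nonempty) (hgrad : ∀ᵐ y ∂μ, y ∈ R → ‖fderiv ℝ g y‖ ≤ 1) {P Q : E}
    (hP : P ∈ R) (hQ : Q ∈ R) : |g Q - g P| ≤ ‖Q - P‖ := by
  have hlines : ∀ v : E, ∀ᵐ x ∂μ, ∀ᵐ t : ℝ,
      DifferentiableAt ℝ g (x + t • v) ∧ (x + t • v ∈ R → ‖fderiv ℝ g (x + t • v)‖ ≤ 1) := by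
    intro v
    obtain ⟨N, hN, hNm, hN0⟩ := exists_measurable_superset_of_null
      (ae_iff.1 (hg.ae_differentiableAt.and hgrad))
    have hmeas : MeasurableSet {z : E × ℝ | z.1 + z.2 • v ∉ N} :=
      (hNm.compl).preimage (by fun_prop : Continuous fun z : E × ℝ => z.1 + z.2 • v).measurable
    have : ∀ᵐ x ∂μ, ∀ᵐ t : ℝ, x + t • v ∉ N := by
      rw [Measure.ae_ae_comm hmeas]
      refine Eventually.of_forall fun t => ?_
      exact (measurePreserving_add_right μ (t • v)).quasiMeasurePreserving.ae
        (measure_eq_zero_iff_ae_notMem.1 hN0)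
    filter_upwards [this] with x hx
    filter_upwards [hx] with t ht
    by_contra hcon
    exact ht (hN hcon)
  have hgood : ∀ x v : E, x ∈ R → x + v ∈ R → (∀ᵐ t : ℝ,
      DifferentiableAt ℝ g (x + t • v) ∧ (x + t • v ∈ R → ‖fderiv ℝ g (x + t • v)‖ ≤ 1)) →
      |g (x + v) - g x| ≤ ‖v‖ := by
    intro x v hx hxv hae
    set φ : ℝ → ℝ := fun t => g (x + t • v) with hφ
    have hlip : LipschitzWith (K * ‖v‖₊) φ := by
      refine hg.comp (LipschitzWith.of_dist_le_mul fun s t => ?_)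
      rw [dist_add_left, dist_eq_norm, ← sub_smul, norm_smul, mul_comm, Real.dist_eq,
        Real.norm_eq_abs, coe_nnnorm]
    have hftc := (hlip.lipschitzOnWith (s := Set.uIcc 0 1)).absolutelyContinuousOnInterval
      |>.integral_deriv_eq_sub
    have hb : ‖∫ t in (0 : ℝ)..1, deriv φ t‖ ≤ ‖v‖ * |1 - 0| := by
      refine intervalIntegral.norm_integral_le_of_norm_le_const_ae ?_
      filter_upwards [hae] with t ht htm
      rw [Set.uIoc_of_le zero_le_one] at htm
      have hmem : x + t • v ∈ R := by
        have := hR.add_smul_sub_mem hx hxv ⟨htm.1.le, htm.2⟩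
        rwa [add_sub_cancel_left] at this
      have hline : HasDerivAt (fun t : ℝ => x + t • v) v t := by
        simpa using ((hasDerivAt_id t).smul_const v).const_add x
      have hd : HasDerivAt φ (fderiv ℝ g (x + t • v) v) t :=
        ht.1.hasFDerivAt.comp_hasDerivAt t hline
      rw [hd.deriv]
      calc _ ≤ ‖fderiv ℝ g (x + t • v)‖ * ‖v‖ := ContinuousLinearMap.le_opNorm _ _
        _ ≤ 1 * ‖v‖ := by gcongr; exact ht.2 hmem
        _ = ‖v‖ := one_mul _
    rw [hftc] at hb
    simpa [hφ] using hb
  have hinterior : ∀ P ∈ interior R, ∀ Q ∈ interior R, |g Q - g P| ≤ ‖Q - P‖ := by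
    intro P hP Q hQ
    set v := Q - P with hv
    have hclosed : IsClosed {x | |g (x + v) - g x| ≤ ‖v‖} := by
      have := hg.continuous
      exact isClosed_le (by fun_prop) continuous_const
    have hdense := Measure.dense_of_ae (hlines v)
    have hopen : IsOpen (interior R ∩ {x | x + v ∈ interior R}) :=
      isOpen_interior.inter (isOpen_interior.preimage (by fun_prop))
    have hPmem : P ∈ interior R ∩ {x | x + v ∈ interior R} := by
      refine ⟨hP, ?_⟩
      change P + v ∈ interior R
      rwa [hv, add_sub_cancel]
    have hcl := hdense.open_subset_closure_inter hopen hPmem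
    have : P ∈ {x | |g (x + v) - g x| ≤ ‖v‖} := by
      refine hclosed.closure_subset_iff.2 ?_ hcl
      rintro x ⟨⟨hx1, hx2⟩, hx3⟩
      exact hgood x v (interior_subset hx1) (interior_subset hx2) hx3
    simpa [hv] using this
  have hclosed : IsClosed {z : E × E | |g z.2 - g z.1| ≤ ‖z.2 - z.1‖} := by
    have := hg.continuous
    exact isClosed_le (by fun_prop) (by fun_prop)
  have hsub := hclosed.closure_subset_iff.2
    (fun z (hz : z ∈ interior R ×ˢ interior R) => hinterior z.1 hz.1 z.2 hz.2)
  have hcl := hR.closure_interior_eq_closure_of_nonempty_interior hint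
  have hPQ : (P, Q) ∈ closure (interior R ×ˢ interior R) := by
    rw [closure_prod_eq, hcl]
    exact ⟨subset_closure hP, subset_closure hQ⟩
  exact hsub hPQ

lemma exists_pos_le_pow {s : ℝ} (hs : 0 < s) (N : ℕ) : ∃ m > 0, ∀ k ≤ N, m ≤ s ^ k := by
  refine ⟨min 1 s ^ N, by positivity, fun k hk => ?_⟩
  calc min 1 s ^ N ≤ min 1 s ^ k :=
        pow_le_pow_of_le_one (by positivity) (min_le_left _ _) hk
    _ ≤ s ^ k := by gcongr; exact min_le_right _ _

/-- If a function is differentiable at `y`, and at all small scales it expands no edge of the first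
`N` descendants of some tile around `y`, then its gradient at `y` has norm at most `1`: the
directions of these edges come close to the direction of the gradient. -/
lemma norm_fderiv_le_one {a b c : ℝ} (p : AngleTriple a b c) (hirr : Irrational (a / π))
    {g : Plane → ℝ} {y : Plane} (hg : DifferentiableAt ℝ g y)
    (hedge : ∀ N : ℕ, ∀ η > 0, ∃ τ : Tile, IsShape a b c τ ∧ y ∈ τ.region ∧ dist τ.A τ.B < η ∧
      ∀ k ≤ N, ∃ q ∈ τ.region, ∃ r ∈ τ.region, |g r - g q| ≤ dist q r ∧
        dist q r = scale a c ^ k * dist τ.A τ.B ∧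
        r - q = (scale a c ^ k * dist τ.A τ.B) • ((turn a)^[k] (τ.dirB, τ.dirC)).1) :
    ‖fderiv ℝ g y‖ ≤ 1 := by
  set L := fderiv ℝ g y with hL
  set v : Plane := (InnerProductSpace.toDual ℝ Plane).symm L with hv
  have hvL : ∀ x, inner ℝ v x = L x := fun x => InnerProductSpace.toDual_symm_apply
  have hnv : ‖v‖ = ‖L‖ := LinearIsometryEquiv.norm_map _ _
  rw [← hnv]
  by_contra! hcon
  have hsc := p.sin_c_pos
  -- `ε` and `δ` are chosen so that `1 + δ < (1 - ε) * ‖v‖`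
  set ε := (‖v‖ - 1) / (3 * ‖v‖) with hε
  have hv0 : 0 < ‖v‖ := by linarith
  have hε0 : 0 < ε := div_pos (by linarith) (by positivity)
  set δ := (‖v‖ - 1) / 3 with hδ
  have hδ0 : 0 < δ := div_pos (by linarith) (by norm_num)
  have hεv : (1 - ε) * ‖v‖ = ‖v‖ - δ := by rw [hε, hδ]; field_simp
  obtain ⟨N, hN⟩ := exists_uniform_cos hirr hε0
  obtain ⟨m, hm0, hm⟩ := exists_pos_le_pow p.scale_pos N
  set e := δ * m * Real.sin c / 4 with he
  have he0 : 0 < e := by positivity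
  obtain ⟨η, hη0, hη⟩ := Metric.eventually_nhds_iff.1
    (hg.hasFDerivAt.isLittleO.def he0)
  obtain ⟨τ, hτ, hyτ, hlt, hk⟩ := hedge N (η * Real.sin c / 2) (by positivity)
  set ℓ := dist τ.A τ.B with hℓ
  obtain ⟨hℓ0, hball, hphase⟩ : 0 < ℓ ∧ τ.region ⊆ Metric.closedBall τ.A (ℓ / Real.sin c) ∧
      ∃ φ : ℝ, inner ℝ v τ.dirB = ‖v‖ * Real.cos φ ∧
        inner ℝ v τ.dirC = ‖v‖ * Real.cos (φ - a) := by
    rcases hτ with h | h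
    · exact ⟨dist_pos.2 h.ne, h.region_subset_closedBall p, exists_phase p.sin_a_pos.ne'
        h.norm_dirB (h.norm_dirC p) (h.inner_dirB_dirC p) v⟩
    · have hb := h.region_subset_closedBall p.conj
      rw [Real.sin_pi_sub] at hb
      exact ⟨dist_pos.2 h.ne, hb, exists_phase p.sin_a_pos.ne'
        h.norm_dirB (h.norm_dirC p.conj) (h.inner_dirB_dirC p.conj) v⟩
  have hdist : ∀ x ∈ τ.region, dist x y ≤ 2 * (ℓ / Real.sin c) := by
    intro x hx
    have h1 := hball hx
    have h2 := hball hyτ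
    rw [Metric.mem_closedBall] at h1 h2
    linarith [dist_triangle_right x y τ.A]
  have hsmall : 2 * (ℓ / Real.sin c) < η := by
    rw [mul_div_assoc', div_lt_iff₀ hsc]
    linarith
  have happrox : ∀ x ∈ τ.region, |g x - g y - L (x - y)| ≤ e * (2 * (ℓ / Real.sin c)) := by
    intro x hx
    have h1 := hη ((hdist x hx).trans_lt hsmall)
    rw [Real.norm_eq_abs, ← dist_eq_norm] at h1
    exact h1.trans (by gcongr; exact hdist x hx)
  obtain ⟨φ, hφB, hφC⟩ := hphase
  obtain ⟨k, hkN, hcos⟩ := hN φ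
  obtain ⟨q, hq, r, hr, hgqr, hqr, hdir⟩ := hk k hkN
  have h1 := happrox q hq
  have h2 := happrox r hr
  have h3 : |L (r - q)| ≤ dist q r + 2 * (e * (2 * (ℓ / Real.sin c))) := by
    have : L (r - q) = (g r - g q) - (g r - g y - L (r - y)) + (g q - g y - L (q - y)) := by
      have : r - q = (r - y) - (q - y) := by abel
      rw [this, map_sub]; ring
    rw [this]
    rw [abs_le] at h1 h2 hgqr ⊢
    constructor <;> linarith [h1.1, h1.2, h2.1, h2.2, hgqr.1, hgqr.2]
  have h4 : |L (r - q)| = scale a c ^ k * ℓ * (‖v‖ * |Real.cos (φ + k * a)|) := by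
    have hpos : 0 ≤ scale a c ^ k * ℓ := by have := p.scale_pos; positivity
    rw [← abs_inner_turn_iterate hφB hφC, hdir, map_smul, smul_eq_mul, abs_mul,
      abs_of_nonneg hpos, hvL]
  have h5 : 2 * (e * (2 * (ℓ / Real.sin c))) = δ * m * ℓ := by
    rw [he]; field_simp; ring
  rw [h4, h5, hqr] at h3
  have h6 : δ * m * ℓ ≤ δ * (scale a c ^ k * ℓ) := by
    rw [mul_assoc]; gcongr; exact hm k hkN
  have hpos : 0 < scale a c ^ k * ℓ := mul_pos (pow_pos p.scale_pos k) hℓ0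
  have h7 : ‖v‖ * |Real.cos (φ + k * a)| ≤ 1 + δ := by
    refine le_of_mul_le_mul_left ?_ hpos
    linarith
  have h8 : (1 - ε) * ‖v‖ ≤ ‖v‖ * |Real.cos (φ + k * a)| := by
    rw [mul_comm]; gcongr
  rw [hεv] at h8
  have : 3 * δ = ‖v‖ - 1 := by rw [hδ]; ring
  linarith

/-! ### The limit of the skeleton distances -/

/-- For an increasing sequence of sets with a uniform chord bound, the limit of the distances from
`P` within these sets is a Lipschitz function on their union, and `g` is an extension of it to the
whole plane. It expands no segment contained in one of the sets. -/
lemma exists_lipschitz_limit {X : ℕ → Set Plane} (hX : Monotone X) {K : NNReal}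
    (hK : ∀ m, ChordBound K (X m)) {n : ℕ} {P : Plane} (hP : P ∈ X n) :
    ∃ g : Plane → ℝ, LipschitzWith K g ∧ g P = 0 ∧
      (∀ Q ∈ X n, ⨅ m, setDist (X m) P Q = ENNReal.ofReal (g Q)) ∧
      ∀ m q r, segment ℝ q r ⊆ X m → |g r - g q| ≤ dist q r := by
  set d : Plane → ℝ≥0∞ := fun y => ⨅ m, setDist (X m) P y with hd
  have hfin : ∀ m, ∀ y ∈ X m, d y ≠ ∞ := by
    intro m y hy
    have h1 := hK (max m n) P (hX (le_max_right m n) hP) y (hX (le_max_left m n) hy)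
    exact ne_top_of_le_ne_top (ENNReal.mul_ne_top ENNReal.coe_ne_top (edist_ne_top P y))
      ((iInf_le _ (max m n)).trans h1)
  have hstep : ∀ m x y, setDist (X m) x y + d x ≥ d y := by
    intro m x y
    simp only [hd, ENNReal.add_iInf]
    refine le_iInf fun i => (iInf_le _ (max m i)).trans ?_
    rw [add_comm]
    exact (setDist_triangle _ P x y).trans (add_le_add (setDist_mono (hX (le_max_right m i)) P x)
      (setDist_mono (hX (le_max_left m i)) x y))
  have hreal : ∀ m, ∀ x ∈ X m, ∀ y ∈ X m, ∀ s : ℝ, 0 ≤ s → setDist (X m) x y ≤ ENNReal.ofReal s →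
      (d y).toReal ≤ (d x).toReal + s := by
    intro m x hx y hy s hs h
    have h1 : d y ≤ ENNReal.ofReal s + d x := (hstep m x y).trans (by gcongr)
    have h2 := ENNReal.toReal_mono (ENNReal.add_ne_top.2 ⟨ENNReal.ofReal_ne_top, hfin m x hx⟩) h1
    rw [ENNReal.toReal_add ENNReal.ofReal_ne_top (hfin m x hx), ENNReal.toReal_ofReal hs] at h2
    linarith
  have hlip : LipschitzOnWith K (fun y => (d y).toReal) (⋃ m, X m) := by
    refine LipschitzOnWith.of_le_add_mul K fun x hx y hy => ?_
    obtain ⟨i, hi⟩ := Set.mem_iUnion.1 hx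
    obtain ⟨j, hj⟩ := Set.mem_iUnion.1 hy
    have hi' := hX (le_max_left i j) hi
    have hj' := hX (le_max_right i j) hj
    refine hreal (max i j) y hj' x hi' _ (by positivity) ((hK _ y hj' x hi').trans_eq ?_)
    rw [ENNReal.ofReal_mul K.coe_nonneg, ENNReal.ofReal_coe_nnreal, edist_dist, dist_comm]
  obtain ⟨g, hg, hgd⟩ := hlip.extend_real
  have hval : ∀ m, ∀ y ∈ X m, g y = (d y).toReal := fun m y hy =>
    (hgd (Set.mem_iUnion.2 ⟨m, hy⟩)).symm
  refine ⟨g, hg, ?_, fun Q hQ => ?_, fun m q r hqr => ?_⟩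
  · have h0 : d P ≤ 0 := by
      refine (iInf_le _ n).trans ((setDist_le_edist ?_).trans_eq (edist_self P))
      rw [segment_same]
      exact Set.singleton_subset_iff.2 hP
    rw [hval n P hP, nonpos_iff_eq_zero.1 h0, ENNReal.toReal_zero]
  · rw [hval n Q hQ, ENNReal.ofReal_toReal (hfin n Q hQ)]
  · have hq := hqr (left_mem_segment ℝ q r)
    have hr := hqr (right_mem_segment ℝ q r)
    rw [hval m q hq, hval m r hr]
    have h1 := hreal m q hq r hr _ dist_nonneg ((setDist_le_edist hqr).trans_eq (edist_dist q r))
    rw [segment_symm] at hqr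
    have h2 := hreal m r hr q hq _ dist_nonneg ((setDist_le_edist hqr).trans_eq (edist_dist r q))
    rw [dist_comm r q] at h2
    rw [abs_le]
    constructor <;> linarith

lemma dist_AB_le_meshSize {S : Set Tile} {τ : Tile} (hτ : τ ∈ S) :
    ENNReal.ofReal (dist τ.A τ.B) ≤ meshSize S := by
  rw [← edist_dist]
  have hA : τ.A ∈ τ.region := subset_convexHull ℝ _ (by simp)
  have hB : τ.B ∈ τ.region := subset_convexHull ℝ _ (by simp)
  exact (Metric.edist_le_ediam_of_mem hA hB).trans
    (le_iSup₂ (f := fun (τ : Tile) (_ : τ ∈ S) => Metric.ediam τ.region) τ hτ)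

lemma interior_region_nonempty {T : Tile} (hT : T.Nondegenerate) :
    (interior T.region).Nonempty := by
  rw [Tile.region, interior_convexHull_nonempty_iff_affineSpan_eq_top]
  have h := AffineIndependent.affineSpan_eq_top_iff_card_eq_finrank_add_one hT |>.2 (by simp)
  rwa [Matrix.range_cons, Matrix.range_cons, Matrix.range_cons_empty, Set.singleton_union,
    Set.singleton_union] at h

open EuclideanGeometry in
lemma angleTriple_of_nondegenerate {T : Tile} (hT : T.Nondegenerate)
    (hac : T.angleA < T.angleC) :
    AngleTriple T.angleA T.angleB T.angleC ∧ T.HasAngles T.angleA T.angleB T.angleC := by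
  have hcol : ¬Collinear ℝ {T.A, T.B, T.C} := affineIndependent_iff_not_collinear_set.1 hT
  have hne := ne₁₂_of_not_collinear hcol
  refine ⟨⟨?_, angle_pos_of_not_collinear hcol, hac, ?_⟩, ⟨hne, rfl, rfl, rfl⟩⟩
  · exact angle_pos_of_not_collinear (by rwa [Set.insert_comm])
  · have := angle_add_angle_add_angle_eq_pi T.C hne.symm
    simp only [Tile.angleA, Tile.angleB, Tile.angleC]
    linarith [angle_comm T.B T.C T.A, angle_comm T.C T.A T.B]

end Pinwheel

open Pinwheel in
theorem mainTheorem3 (T : Pinwheel.Tile) (hT : T.Nondegenerate)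
    (hac : T.angleA < T.angleC) (hirr : Irrational (T.angleA / π))
    (𝒯 : ℕ → Set Pinwheel.Tile)
    (htiling : ∀ i, Pinwheel.IsTiling T (𝒯 i))
    (hrefines : ∀ i, Pinwheel.Refines (𝒯 (i + 1)) (𝒯 i))
    (hmesh : Tendsto (fun i => Pinwheel.meshSize (𝒯 i)) atTop (𝓝 0))
    (n : ℕ) (P Q : Pinwheel.Plane)
    (hP : P ∈ Pinwheel.skeleton (𝒯 n)) (hQ : Q ∈ Pinwheel.skeleton (𝒯 n)) (hPQ : P ≠ Q) :
    Tendsto (fun m => Pinwheel.skeletonDist (𝒯 m) P Q) atTop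
      (𝓝 (ENNReal.ofReal ‖P - Q‖)) := by
  obtain ⟨p, hang⟩ := angleTriple_of_nondegenerate hT hac
  set a := T.angleA
  set b := T.angleB
  set c := T.angleC
  have hshape : IsShape a b c T := Or.inl hang
  have hmem : ∀ i, ∀ ρ ∈ 𝒯 i, IsShape a b c ρ := fun i => (htiling i).isShape p hshape
  have href : ∀ i j, i ≤ j → Refines (𝒯 j) (𝒯 i) := by
    intro i j hij
    induction j, hij using Nat.le_induction with
    | base => exact fun τ hτ => ⟨{τ}, Set.singleton_subset_iff.2 hτ, IsTiling.root τ⟩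
    | succ j _ ih => exact ih.trans (hrefines j)
  have hmono : Monotone fun i => skeleton (𝒯 i) := by
    intro i j hij
    refine Set.iUnion₂_subset fun τ hτ => ?_
    obtain ⟨R, hRS, hR⟩ := href i j hij τ hτ
    exact (hR.boundary_subset_skeleton p (hmem i τ hτ)).trans (Set.biUnion_subset_biUnion_left hRS)
  have hα : 0 < min a (min b (c - a)) :=
    lt_min p.a_pos (lt_min p.b_pos (sub_pos.2 p.a_lt_c))
  have hchord : ∀ m, ChordBound (cornerConst (min a (min b (c - a)))) (skeleton (𝒯 m)) :=
    fun m => (htiling m).chordBound p hα (min_le_left _ _)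
      ((min_le_right _ _).trans (min_le_left _ _)) ((min_le_right _ _).trans (min_le_right _ _))
      hshape
  obtain ⟨g, hglip, hgP, hgQ, hgseg⟩ := exists_lipschitz_limit hmono hchord hP
  have hsmall : ∀ η > 0, ∀ i, ∃ j ≥ i, ∀ τ ∈ 𝒯 j, dist τ.A τ.B < η := by
    intro η hη i
    obtain ⟨j, hj, hij⟩ := ((hmesh.eventually_lt_const (ENNReal.ofReal_pos.2 hη)).and
      (eventually_ge_atTop i)).exists
    exact ⟨j, hij, fun τ hτ => (ENNReal.ofReal_lt_ofReal_iff hη).1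
      ((dist_AB_le_meshSize hτ).trans_lt hj)⟩
  have hgrad : ∀ᵐ y, y ∈ T.region → ‖fderiv ℝ g y‖ ≤ 1 := by
    filter_upwards [hglip.ae_differentiableAt] with y hy hyT
    refine norm_fderiv_le_one p hirr hy fun N η hη => ?_
    obtain ⟨i, -, hi⟩ := hsmall η hη 0
    rw [← (htiling i).biUnion_region p hshape] at hyT
    obtain ⟨τ, hτ, hyτ⟩ := Set.mem_iUnion₂.1 hyT
    have hsτ := hmem i τ hτ
    refine ⟨τ, hsτ, hyτ, hi τ hτ, fun k hk => ?_⟩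
    have hτ0 : 0 < dist τ.A τ.B := dist_pos.2 (hsτ.elim (fun h => h.ne) (fun h => h.ne))
    obtain ⟨m, hm0, hm⟩ := exists_pos_le_pow p.scale_pos N
    -- refine until the first `N` descendants of `τ` are certainly subdivided
    obtain ⟨j, hij, hj⟩ := hsmall (m * dist τ.A τ.B) (by positivity) i
    obtain ⟨R, hRS, hR⟩ := href i j hij τ hτ
    obtain ⟨q, r, hqr, hq, hr, hd, hdir⟩ := hR.exists_edge p k hsτ fun ρ hρ l hl =>
      (hj ρ (hRS hρ)).trans_le (by gcongr; exact hm l (hl.trans hk))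
    exact ⟨q, hq, r, hr, hgseg j q r (hqr.trans (Set.biUnion_subset_biUnion_left hRS)), hd, hdir⟩
  have hregion := (htiling n).skeleton_subset_region p hshape
  have hgPQ := abs_sub_le_of_ae_norm_fderiv_le MeasureTheory.volume hglip (convex_convexHull ℝ _)
    (interior_region_nonempty hT) hgrad (hregion hP) (hregion hQ)
  have hinf : ⨅ m, setDist (skeleton (𝒯 m)) P Q = ENNReal.ofReal ‖P - Q‖ := by
    apply le_antisymm
    · rw [hgQ Q hQ, norm_sub_rev]
      rw [hgP, sub_zero] at hgPQ
      exact ENNReal.ofReal_le_ofReal ((le_abs_self _).trans hgPQ)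
    · refine le_iInf fun m => ?_
      rw [← dist_eq_norm, ← edist_dist]
      exact edist_le_setDist _ P Q
  rw [← hinf]
  exact tendsto_atTop_iInf fun i j hij => setDist_mono (hmono hij) P Q
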